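/- All partitions may have trailing zeros; $(\gamma^\alpha)$ is the rectangular partition with $\alpha$ parts equal to $\gamma$. The inclusion $\pi\subseteq\lambda$ means $\pi_i\le\lambda_i$ for all $i$; $\lambda/\pi$ is the set of squares of the Ferrers diagram of $\lambda$ not in that of $\pi$, $|\lambda/\pi|$ is its number of squares, and it is a horizontal strip if no two of its squares lie in the same column. A semistandard tableau is a filling of a Ferrers diagram with positive integers, weakly increasing along rows and strictly increasing down columns; $x^T=x_1^{\#1\text{'s in }T}x_2^{\#2\text{'s in }T}\cdots$, and $s_\mu(x_1,\dots,x_m)=\sum_T x^T$, summed over the semistandard tableaux $T$ of shape $\mu$ with entries in $\{1,\dots,m\}$. **Theorem.** Let $\alpha,n\ge 0$ and $\gamma_1\ge\gamma_2\ge 0$ be integers, and let $x_1,\dots,x_{n+1}$ be elements of a commutative ring (for instance indeterminates). Then $$\begin{aligned} s_{(\gamma_1^\alpha)}(x_1,\dots,x_n)\,s_{(\gamma_2^\alpha)}(x_1,\dots,x_{n+1}) &=\sum_{\lambda\subseteq(\gamma_2^\alpha)}\ \sum_{\substack{\pi\subseteq\lambda\\ \lambda/\pi\text{ horizontal strip}}}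 x_{n+1}^{|\lambda/\pi|}\, s_{(\gamma_1+\gamma_2-\lambda_\alpha,\,\gamma_1+\gamma_2-\lambda_{\alpha-1},\dots,\gamma_1+\gamma_2-\lambda_1,\,\pi_1,\dots,\pi_\alpha)}(x_1,\dots,x_n)\\ &=\sum_{\lambda\subseteq(\gamma_2^\alpha)}\ \sum_T x^T . \end{aligned}$$ In the last sum $T$ runs over the semistandard tableaux with entries in $\{1,\dots,n+1\}$ whose shape consists of the rectangle $(\gamma_1^\alpha)$ with $\lambda^\circ$ attached to its right side and $\lambda$ attached below it, that is, of shape $(\gamma_1+\lambda^\circ_1,\dots,\gamma_1+\lambda^\circ_\alpha,\lambda_1,\dots,\lambda_\alpha)$, such that entries $n+1$ occur only in the region $\lambda$ (the rows below the first $\alpha$). Here $\lambda^\circ=(\gamma_2-\lambda_\alpha,\dots,\gamma_2-\lambda_1)$ is the complement of $\lambda$ in the rectangle $(\gamma_2^\alpha)$, rotated by $180^\circ$. Moreover, $$\begin{aligned} s_{(\gamma_1^\alpha)}(x_1,\dots,x_n)\,s_{(\gamma_2^{\alpha+1})}(x_1,\dots,x_{n+1}) &=\sum_{\substack{\lambda\subseteq(\gamma_2^{\alpha+1})\\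 \lambda_1=\gamma_2}}\ \sum_{\substack{\pi\subseteq\lambda\\ \lambda/\pi\text{ horizontal strip}}} x_{n+1}^{|\lambda/\pi|}\, s_{(\gamma_1+\gamma_2-\lambda_{\alpha+1},\,\gamma_1+\gamma_2-\lambda_{\alpha},\dots,\gamma_1+\gamma_2-\lambda_2,\,\pi_1,\dots,\pi_{\alpha+1})}(x_1,\dots,x_n)\\ &=\sum_{\substack{\lambda\subseteq(\gamma_2^{\alpha+1})\\ \lambda_1=\gamma_2}}\ \sum_T x^T , \end{aligned}$$ where $T$ runs over the semistandard tableaux with entries in $\{1,\dots,n+1\}$ of shape $(\gamma_1+\lambda^\circ_1,\dots,\gamma_1+\lambda^\circ_\alpha,\lambda_1,\dots,\lambda_{\alpha+1})$ such that entries $n+1$ occur only in the region $\lambda$ (the rows below the first $\alpha$); here $\lambda^\circ=(\gamma_2-\lambda_{\alpha+1},\dots,\gamma_2-\lambda_1)$ is the rotated complement of $\lambda$ in the rectangle $(\gamma_2^{\alpha+1})$, whose last part $\gamma_2-\lambda_1$ is $0$. -/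

import Mathlib

namespace RectSchur

/-- A partition with at most `k` parts, written as a weakly decreasing sequence of length `k`
padded by zeros. The order is the pointwise one, so `π ≤ lam` says that `π` is contained
in `lam`. -/
abbrev Ptn (k : ℕ) : Type := {a : Fin k → ℕ // Antitone a}

/-- The rectangular partition `(g^k)`. -/
def rect (k g : ℕ) : Ptn k := ⟨fun _ => g, fun _ _ _ => le_rfl⟩

/-- The Ferrers diagram of a partition: row `i` (counted from `0`) has `a i` squares. -/
def ferrers {k : ℕ} (a : Ptn k) : YoungDiagram where
  cells := Finset.univ.biUnion fun i : Fin k => (Finset.range (a.1 i)).image fun j => ((i : ℕ), j)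
  isLowerSet := by
    rintro ⟨i, j⟩ ⟨i', j'⟩ hle hmem
    simp only [Finset.coe_biUnion, Finset.coe_univ, Set.mem_univ, Set.iUnion_true, Set.mem_iUnion,
      Finset.coe_image, Set.mem_image, Finset.coe_range, Set.mem_Iio, Prod.mk.injEq] at hmem ⊢
    obtain ⟨r, c, hc, rfl, rfl⟩ := hmem
    obtain ⟨h1, h2⟩ := Prod.mk_le_mk.mp hle
    refine ⟨⟨i', lt_of_le_of_lt h1 r.2⟩, j', ?_, rfl, rfl⟩
    exact lt_of_le_of_lt h2 (lt_of_lt_of_le hc (a.2 (Fin.mk_le_of_le_val h1)))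

theorem mem_ferrers {k : ℕ} (a : Ptn k) (i j : ℕ) :
    (i, j) ∈ ferrers a ↔ ∃ h : i < k, j < a.1 ⟨i, h⟩ := by
  rw [← YoungDiagram.mem_cells]
  simp only [ferrers, Finset.mem_biUnion, Finset.mem_univ, true_and, Finset.mem_image,
    Finset.mem_range, Prod.mk.injEq]
  constructor
  · rintro ⟨r, c, hc, rfl, rfl⟩
    exact ⟨r.2, hc⟩
  · rintro ⟨h, hj⟩
    exact ⟨⟨i, h⟩, j, hj, rfl, rfl⟩

/-- The squares of the skew diagram `lam / π`. -/
def skewCells {k : ℕ} (lam π : Ptn k) : Finset (ℕ × ℕ) :=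
  (ferrers lam).cells \ (ferrers π).cells

/-- `lam / π` is a horizontal strip: no two of its squares lie in the same column. -/
def IsHorizontalStrip {k : ℕ} (lam π : Ptn k) : Prop :=
  ∀ c ∈ skewCells lam π, ∀ d ∈ skewCells lam π, c.2 = d.2 → c = d

/-- Semistandard tableaux of shape `μ` with entries among the first `n` letters. Entries are
counted from `0`, as in Mathlib: the entry `m` stands for the letter `m + 1`, so the letters are
`1, …, n`. -/
abbrev Tableau (μ : YoungDiagram) (n : ℕ) : Type :=
  {T : SemistandardYoungTableau μ // ∀ i j : ℕ, (i, j) ∈ μ → T i j < n}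

instance tableauFinite (μ : YoungDiagram) (n : ℕ) : Finite (Tableau μ n) := by
  refine Finite.of_injective
    (fun (T : Tableau μ n) (c : μ.cells) => (⟨T.1 c.1.1 c.1.2, T.2 _ _ c.2⟩ : Fin n)) ?_
  intro T S hTS
  apply Subtype.ext
  ext i j
  by_cases hc : (i, j) ∈ μ
  · exact congrArg Fin.val (congrFun hTS ⟨(i, j), hc⟩)
  · rw [T.1.zeros hc, S.1.zeros hc]

noncomputable instance tableauFintype (μ : YoungDiagram) (n : ℕ) : Fintype (Tableau μ n) :=
  Fintype.ofFinite _

/-- The monomial `x^T`: the product over all squares of the variable belonging to the entry. -/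
def weight {A : Type*} [CommRing A] {μ : YoungDiagram} {n : ℕ} (x : Fin n → A)
    (T : Tableau μ n) : A :=
  ∏ c : μ.cells, x ⟨T.1 c.1.1 c.1.2, T.2 _ _ c.2⟩

/-- The Schur function `s_a(x_1, …, x_n)`, with `x_1, …, x_n` given as `x 0, …, x (n - 1)`. -/
noncomputable def schur {A : Type*} [CommRing A] {k n : ℕ} (a : Ptn k) (x : Fin n → A) : A :=
  ∑ T : Tableau (ferrers a) n, weight x T

/-- The partitions contained in `(g^k)`. -/
abbrev InBox (k g : ℕ) : Type := {lam : Ptn k // lam ≤ rect k g}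

/-- The partitions `lam` contained in `(g^(k+1))` whose largest part is `g`. -/
abbrev InBoxFull (k g : ℕ) : Type := {lam : InBox (k + 1) g // lam.1.1 0 = g}

/-- The partitions `π` contained in `lam` for which `lam / π` is a horizontal strip. -/
abbrev Strip {k : ℕ} (lam : Ptn k) : Type := {π : Ptn k // π ≤ lam ∧ IsHorizontalStrip lam π}

instance belowFinite {k : ℕ} (lam : Ptn k) : Finite {π : Ptn k // π ≤ lam} := by
  refine Finite.of_injective
    (fun (π : {π : Ptn k // π ≤ lam}) => (⟨π.1.1, π.2⟩ : Set.Iic lam.1)) ?_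
  intro π ρ h
  exact Subtype.ext (Subtype.ext (congrArg (fun t : Set.Iic lam.1 => t.1) h))

instance stripFinite {k : ℕ} (lam : Ptn k) : Finite (Strip lam) :=
  Finite.of_injective (fun π : Strip lam => (⟨π.1, π.2.1⟩ : {π : Ptn k // π ≤ lam}))
    fun _ _ h => Subtype.ext (congrArg (fun t : {π : Ptn k // π ≤ lam} => t.1) h)

noncomputable instance inBoxFintype (k g : ℕ) : Fintype (InBox k g) := Fintype.ofFinite _

noncomputable instance inBoxFullFintype (k g : ℕ) : Fintype (InBoxFull k g) := Fintype.ofFinite _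

noncomputable instance stripFintype {k : ℕ} (lam : Ptn k) : Fintype (Strip lam) :=
  Fintype.ofFinite _

/-- The partition `(f_1, …, f_k, g_1, …, g_l)` obtained by putting `g` below `f`. -/
def stack {k l : ℕ} (f : Fin k → ℕ) (g : Fin l → ℕ) (hf : Antitone f) (hg : Antitone g)
    (hfg : ∀ i j, g j ≤ f i) : Ptn (k + l) :=
  ⟨Fin.append f g, by
    intro i j hij
    induction i using Fin.addCases with
    | left i =>
      induction j using Fin.addCases with
      | left j =>
        simp only [Fin.append_left]
        exact hf (Fin.le_def.mpr (Fin.le_def.mp hij))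
      | right j =>
        simp only [Fin.append_left, Fin.append_right]
        exact hfg i j
    | right i =>
      induction j using Fin.addCases with
      | left j =>
        simp only [Fin.le_def, Fin.val_natAdd, Fin.val_castAdd] at hij
        omega
      | right j =>
        simp only [Fin.append_right]
        exact hg ((Fin.natAdd_le_natAdd_iff k).mp hij)⟩

/-- The rotated complement `lam°` of `lam` in the rectangle `(g^k)`; its parts are
`g - lam_k ≥ … ≥ g - lam_1`. -/
def rotCompl {k g : ℕ} (lam : InBox k g) : Ptn k :=
  ⟨fun i => g - lam.1.1 i.rev, fun _ _ h =>
    Nat.sub_le_sub_left (lam.1.2 (Fin.rev_le_rev.mpr h)) g⟩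

/-- The partition `(g₁+g₂-lam_k, …, g₁+g₂-lam_1, π_1, …, π_k)`. -/
def shapeA {k g₁ g₂ : ℕ} (h : g₂ ≤ g₁) (lam : InBox k g₂) (π : Strip lam.1) : Ptn (k + k) :=
  stack (fun i => g₁ + g₂ - lam.1.1 i.rev) π.1.1
    (fun _ _ hij => Nat.sub_le_sub_left (lam.1.2 (Fin.rev_le_rev.mpr hij)) _) π.1.2
    (fun i j => by
      have h1 : π.1.1 j ≤ lam.1.1 j := π.2.1 j
      have h2 : lam.1.1 j ≤ g₂ := lam.2 j
      have h3 : lam.1.1 i.rev ≤ g₂ := lam.2 i.rev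
      omega)

/-- The composite shape: the rectangle `(g₁^k)`, with `lam°` attached to its right side and `lam`
attached below it. The region `lam` consists of the rows with index at least `k`. -/
def tableauShapeA {k g₁ g₂ : ℕ} (h : g₂ ≤ g₁) (lam : InBox k g₂) : YoungDiagram :=
  ferrers <| stack (fun i => g₁ + (rotCompl lam).1 i) lam.1.1
    (fun _ _ hij => Nat.add_le_add_left ((rotCompl lam).2 hij) _) lam.1.2
    (fun i j => by
      have h2 : lam.1.1 j ≤ g₂ := lam.2 j
      omega)

/-- The partition `(g₁+g₂-lam_{k+1}, …, g₁+g₂-lam_2, π_1, …, π_{k+1})`. -/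
def shapeB {k g₁ g₂ : ℕ} (h : g₂ ≤ g₁) (lam : InBoxFull k g₂) (π : Strip lam.1.1) :
    Ptn (k + (k + 1)) :=
  stack (fun i : Fin k => g₁ + g₂ - lam.1.1.1 i.castSucc.rev) π.1.1
    (fun _ _ hij => Nat.sub_le_sub_left
      (lam.1.1.2 (Fin.rev_le_rev.mpr (Fin.castSucc_le_castSucc_iff.mpr hij))) _) π.1.2
    (fun i j => by
      have h1 : π.1.1 j ≤ lam.1.1.1 j := π.2.1 j
      have h2 : lam.1.1.1 j ≤ g₂ := lam.1.2 j
      have h3 : lam.1.1.1 i.castSucc.rev ≤ g₂ := lam.1.2 i.castSucc.rev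
      omega)

/-- The composite shape: the rectangle `(g₁^k)`, with the rotated complement `lam°` of `lam` in
`(g₂^(k+1))` attached to its right side (the part `g₂ - lam_1` in row `k + 1` of `lam°` is `0`) and
`lam` attached below it. The region `lam` consists of the rows with index at least `k`. -/
def tableauShapeB {k g₁ g₂ : ℕ} (h : g₂ ≤ g₁) (lam : InBoxFull k g₂) : YoungDiagram :=
  ferrers <| stack (fun i : Fin k => g₁ + (rotCompl lam.1).1 i.castSucc) lam.1.1.1
    (fun _ _ hij => Nat.add_le_add_left
      ((rotCompl lam.1).2 (Fin.castSucc_le_castSucc_iff.mpr hij)) _) lam.1.1.2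
    (fun i j => by
      have h2 : lam.1.1.1 j ≤ g₂ := lam.1.2 j
      omega)

/-- Semistandard tableaux of shape `μ` with entries in `{1, …, n+1}` in which the largest letter
`n + 1` (stored as `n`) occurs only in rows with index at least `r` (counted from `0`). -/
abbrev RestrictedTableau (μ : YoungDiagram) (n r : ℕ) : Type :=
  {T : Tableau μ (n + 1) // ∀ i j : ℕ, (i, j) ∈ μ → T.1 i j = n → r ≤ i}

noncomputable instance restrictedTableauFintype (μ : YoungDiagram) (n r : ℕ) :
    Fintype (RestrictedTableau μ n r) :=
  Fintype.ofFinite _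

end RectSchur

namespace RectSchur

/-! Split the first `n` letters `w` into a block `u` of `α` letters and a block `v` of the others,
and let `y` be the last letter. Two facts are combined. Splitting the alphabet (`sum_complBox`,
`schur_rect_snoc`): the rectangular Schur function of `(w, y)` is the sum over `lam` in the box of
`s_{lam°}(u) s_lam(v, y)`, and branching on `y` turns `s_lam(v, y)` into a sum of `y^{|lam/π|}
s_π(v)` over horizontal strips. Laplace expansion (`antisymm_schur_mul_schur`): multiply
`s_{lam°}(u) s_π(v)` by the two Vandermonde determinants and a power of the product of `u`, then
antisymmetrize over all permutations of `w`. By the bialternant formula the result is a fixed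
multiple of `s_{(γ₁ + lam°, π)}(w)`. For empty partitions it is the same multiple of
`s_{(γ₁^α)}(w)`. Since the second factor of the product is symmetric in `w`, it passes through the
antisymmetrization (`antisymm_mul_schur_rect`); expanding it inside instead gives the first form of
each identity, after cancelling the common multiple over `ℤ[X]` and specializing. For the rectangle
with `α + 1` rows, `s_{lam°}(u)` vanishes unless `lam°` has at most `α` parts, that is, `lam_1 =
γ₂`. The case `n < α` is treated directly. The tableau forms follow by removing the largest letter
from tableaux in which it avoids the top rows. -/

theorem isHorizontalStrip_iff {k : ℕ} {lam π : Ptn k} :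
    IsHorizontalStrip lam π ↔ ∀ i j : Fin k, i < j → lam.1 j ≤ π.1 i := by
  have mem : ∀ i j : ℕ, (i, j) ∈ skewCells lam π ↔
      ∃ h : i < k, j < lam.1 ⟨i, h⟩ ∧ π.1 ⟨i, h⟩ ≤ j := by
    intro i j
    rw [skewCells, Finset.mem_sdiff, YoungDiagram.mem_cells, YoungDiagram.mem_cells,
      mem_ferrers, mem_ferrers]
    constructor
    · rintro ⟨⟨h1, h2⟩, h3⟩
      exact ⟨h1, h2, not_lt.mp fun h4 => h3 ⟨h1, h4⟩⟩
    · rintro ⟨h1, h2, h3⟩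
      exact ⟨⟨h1, h2⟩, fun ⟨_, h4⟩ => absurd h4 (not_lt.mpr h3)⟩
  constructor
  · intro hs i j hij
    by_contra hlt
    push Not at hlt
    -- If `lam_j > π_i`, column `π_i` contains skew squares in both rows `i` and `j`.
    have h1 : ((i : ℕ), π.1 i) ∈ skewCells lam π :=
      (mem _ _).2 ⟨i.2, lt_of_lt_of_le hlt (lam.2 hij.le), le_rfl⟩
    have h2 : ((j : ℕ), π.1 i) ∈ skewCells lam π := (mem _ _).2 ⟨j.2, hlt, π.2 hij.le⟩
    have h3 := congrArg Prod.fst (hs _ h1 _ h2 rfl)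
    exact absurd (Fin.ext h3) hij.ne
  · rintro hs ⟨i, c⟩ hc ⟨j, d⟩ hd (rfl : c = d)
    obtain ⟨hi, hc1, hc2⟩ := (mem _ _).1 hc
    obtain ⟨hj, hd1, hd2⟩ := (mem _ _).1 hd
    rcases lt_trichotomy i j with hij | rfl | hij
    · have := hs ⟨i, hi⟩ ⟨j, hj⟩ hij
      omega
    · rfl
    · have := hs ⟨j, hj⟩ ⟨i, hi⟩ hij
      omega

theorem card_ferrers {k : ℕ} (a : Ptn k) : (ferrers a).cells.card = ∑ i, a.1 i := by
  rw [ferrers, Finset.card_biUnion]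
  · refine Finset.sum_congr rfl fun i _ => ?_
    rw [Finset.card_image_of_injective _ (fun _ _ h => (Prod.mk.inj h).2), Finset.card_range]
  · intro i _ j _ hij
    rw [Function.onFun, Finset.disjoint_left]
    simp only [Finset.mem_image, not_exists, not_and]
    rintro _ ⟨c, _, rfl⟩ d _ h
    exact hij (Fin.ext (Prod.mk.inj h).1.symm)

theorem ferrers_mono {k : ℕ} {π lam : Ptn k} (h : π ≤ lam) :
    (ferrers π).cells ⊆ (ferrers lam).cells := by
  rintro ⟨i, j⟩ hc
  obtain ⟨hi, hj⟩ := (mem_ferrers _ _ _).1 ((YoungDiagram.mem_cells _).1 hc)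
  exact (YoungDiagram.mem_cells _).2 ((mem_ferrers _ _ _).2 ⟨hi, lt_of_lt_of_le hj (h _)⟩)

theorem card_skewCells_add {k : ℕ} {lam π : Ptn k} (h : π ≤ lam) :
    (skewCells lam π).card + ∑ i, π.1 i = ∑ i, lam.1 i := by
  rw [← card_ferrers, ← card_ferrers, skewCells]
  exact Finset.card_sdiff_add_card_eq_card (ferrers_mono h)

theorem card_skewCells {k : ℕ} {lam π : Ptn k} (h : π ≤ lam) :
    (skewCells lam π).card = ∑ i, (lam.1 i - π.1 i) := by
  have h1 := card_skewCells_add h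
  have h2 : ∑ i, (lam.1 i - π.1 i) + ∑ i, π.1 i = ∑ i, lam.1 i := by
    rw [← Finset.sum_add_distrib]
    exact Finset.sum_congr rfl fun i _ => Nat.sub_add_cancel (h i)
  omega

theorem ext_of_mem_ferrers {k : ℕ} {a b : Ptn k}
    (h : ∀ i j, (i, j) ∈ ferrers a ↔ (i, j) ∈ ferrers b) : a = b := by
  refine Subtype.ext (funext fun i => ?_)
  have key : ∀ j, j < a.1 i ↔ j < b.1 i := by
    intro j
    have := h i j
    rw [mem_ferrers, mem_ferrers] at this
    exact ⟨fun hj => (this.1 ⟨i.2, hj⟩).2, fun hj => (this.2 ⟨i.2, hj⟩).2⟩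
  have h1 := key (a.1 i)
  have h2 := key (b.1 i)
  omega

/-! ### Removing the largest letter from a tableau -/

section Branching

variable {k n r : ℕ} {b : Ptn k}

/-- The squares of a tableau whose entries are smaller than `n`. -/
def smallDiagram (T : RestrictedTableau (ferrers b) n r) : YoungDiagram where
  cells := (ferrers b).cells.filter fun c => T.1.1 c.1 c.2 < n
  isLowerSet := by
    rintro ⟨i, j⟩ ⟨i', j'⟩ hle hmem
    obtain ⟨h1, h2⟩ := Prod.mk_le_mk.mp hle
    simp only [Finset.coe_filter, Set.mem_ofPred_eq, YoungDiagram.mem_cells] at hmem ⊢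
    refine ⟨(ferrers b).up_left_mem h1 h2 hmem.1, lt_of_le_of_lt ?_ hmem.2⟩
    exact (T.1.1.row_weak_of_le h2 ((ferrers b).up_left_mem h1 le_rfl hmem.1)).trans
      (T.1.1.col_weak h1 hmem.1)

theorem mem_smallDiagram (T : RestrictedTableau (ferrers b) n r) (i j : ℕ) :
    (i, j) ∈ smallDiagram T ↔ (i, j) ∈ ferrers b ∧ T.1.1 i j < n := by
  rw [← YoungDiagram.mem_cells, smallDiagram, Finset.mem_filter, YoungDiagram.mem_cells]

/-- The row lengths of the part of a tableau filled with entries smaller than `n`. -/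
def smallPtn (T : RestrictedTableau (ferrers b) n r) : Ptn k :=
  ⟨fun i => (smallDiagram T).rowLen i, fun _ _ h => (smallDiagram T).rowLen_anti _ _ h⟩

theorem mem_smallPtn (T : RestrictedTableau (ferrers b) n r) (i j : ℕ) :
    (i, j) ∈ ferrers (smallPtn T) ↔ (i, j) ∈ ferrers b ∧ T.1.1 i j < n := by
  rw [← mem_smallDiagram, mem_ferrers, YoungDiagram.mem_iff_lt_rowLen]
  constructor
  · rintro ⟨_, h⟩
    exact h
  · intro h
    have h1 := ((mem_smallDiagram T i j).1 (YoungDiagram.mem_iff_lt_rowLen.2 h)).1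
    exact ⟨((mem_ferrers _ _ _).1 h1).1, h⟩

theorem smallPtn_le (T : RestrictedTableau (ferrers b) n r) : smallPtn T ≤ b := by
  intro i
  by_contra hlt
  push Not at hlt
  have h1 : ((i : ℕ), b.1 i) ∈ ferrers (smallPtn T) := (mem_ferrers _ _ _).2 ⟨i.2, hlt⟩
  have h2 := ((mem_ferrers _ _ _).1 ((mem_smallPtn T _ _).1 h1).1).2
  exact lt_irrefl _ h2

theorem smallPtn_strip (T : RestrictedTableau (ferrers b) n r) :
    IsHorizontalStrip b (smallPtn T) := by
  rw [isHorizontalStrip_iff]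
  intro i j hij
  by_contra hlt
  push Not at hlt
  have h1 : ((j : ℕ), (smallPtn T).1 i) ∈ ferrers b := (mem_ferrers _ _ _).2 ⟨j.2, hlt⟩
  -- This square lies strictly above a square of `b` whose entry is at most `n`.
  have h2 : T.1.1 i ((smallPtn T).1 i) < n := by
    have := T.1.1.col_strict (show (i : ℕ) < j from hij) h1
    have := T.1.2 _ _ h1
    omega
  have h3 := (mem_smallPtn T i ((smallPtn T).1 i)).2
    ⟨(ferrers b).up_left_mem (le_of_lt hij) le_rfl h1, h2⟩
  exact lt_irrefl _ ((mem_ferrers _ _ _).1 h3).2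

theorem smallPtn_eq_of_lt (T : RestrictedTableau (ferrers b) n r) (i : Fin k) (hi : (i : ℕ) < r) :
    (smallPtn T).1 i = b.1 i := by
  refine le_antisymm (smallPtn_le T i) ?_
  by_contra hlt
  push Not at hlt
  have h1 : ((i : ℕ), (smallPtn T).1 i) ∈ ferrers b := (mem_ferrers _ _ _).2 ⟨i.2, hlt⟩
  have h2 : T.1.1 i ((smallPtn T).1 i) < n := by
    have h3 := T.1.2 _ _ h1
    have h4 := T.2 _ _ h1
    omega
  exact lt_irrefl _ ((mem_ferrers _ _ _).1 ((mem_smallPtn T _ _).2 ⟨h1, h2⟩)).2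

/-- The default value `1` removes the dependence on membership proofs, so the product can be split
over sets of squares. -/
theorem weight_eq_prod {A : Type*} [CommRing A] {μ : YoungDiagram} {n : ℕ} (x : Fin n → A)
    (T : Tableau μ n) :
    weight x T = ∏ c ∈ μ.cells, if h : T.1 c.1 c.2 < n then x ⟨T.1 c.1 c.2, h⟩ else 1 := by
  rw [weight, ← Finset.prod_coe_sort μ.cells]
  exact Finset.prod_congr rfl fun c _ => by rw [dif_pos (T.2 _ _ c.2)]

/-- Fill the squares of `b / π` with the letter `n`. -/
def fillLargest {π : Ptn k} (hle : π ≤ b) (hs : IsHorizontalStrip b π)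
    (hr : ∀ i : Fin k, (i : ℕ) < r → π.1 i = b.1 i) (S : Tableau (ferrers π) n) :
    RestrictedTableau (ferrers b) n r :=
  have hsub : ∀ {i j : ℕ}, (i, j) ∈ ferrers π → (i, j) ∈ ferrers b := fun h =>
    (YoungDiagram.mem_cells _).1 (ferrers_mono hle ((YoungDiagram.mem_cells _).2 h))
  ⟨⟨{ entry := fun i j => if (i, j) ∈ ferrers π then S.1 i j
        else if (i, j) ∈ ferrers b then n else 0
      row_weak' := by
        intro i j1 j2 hj h
        rw [if_pos h, if_pos ((ferrers b).up_left_mem le_rfl hj.le h)]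
        by_cases h2 : (i, j2) ∈ ferrers π
        · rw [if_pos h2, if_pos ((ferrers π).up_left_mem le_rfl hj.le h2)]
          exact S.1.row_weak hj h2
        · rw [if_neg h2]
          split_ifs with h1
          · exact (S.2 _ _ h1).le
          · exact le_rfl
      col_strict' := by
        intro i1 i2 j hi h
        obtain ⟨hk2, hj2⟩ := (mem_ferrers _ _ _).1 h
        -- The strip condition puts every square lying above a square of `b` into `π`.
        have h1 : (i1, j) ∈ ferrers π := (mem_ferrers _ _ _).2 ⟨hi.trans hk2,
          lt_of_lt_of_le hj2 (isHorizontalStrip_iff.1 hs ⟨i1, hi.trans hk2⟩ ⟨i2, hk2⟩ hi)⟩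
        rw [if_pos h1, if_pos h]
        split_ifs with h2
        · exact S.1.col_strict hi h2
        · exact S.2 _ _ h1
      zeros' := by
        intro i j h
        rw [if_neg h, if_neg fun h' => h (hsub h')] }, by
    intro i j h
    change (if (i, j) ∈ ferrers π then S.1 i j else if (i, j) ∈ ferrers b then n else 0) < n + 1
    split_ifs with h1
    · exact (S.2 _ _ h1).trans (Nat.lt_succ_self n)
    · exact Nat.lt_succ_self n⟩, by
    intro i j h hn
    change (if (i, j) ∈ ferrers π then S.1 i j else if (i, j) ∈ ferrers b then n else 0) = n at hn
    by_contra hlt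
    push Not at hlt
    obtain ⟨hk, hj⟩ := (mem_ferrers _ _ _).1 h
    have h1 : (i, j) ∈ ferrers π := (mem_ferrers _ _ _).2 ⟨hk, (hr ⟨i, hk⟩ hlt).symm ▸ hj⟩
    rw [if_pos h1] at hn
    exact absurd (S.2 _ _ h1) (by omega)⟩

theorem fillLargest_apply {π : Ptn k} (hle : π ≤ b) (hs : IsHorizontalStrip b π)
    (hr : ∀ i : Fin k, (i : ℕ) < r → π.1 i = b.1 i) (S : Tableau (ferrers π) n) (i j : ℕ) :
    (fillLargest hle hs hr S).1.1 i j =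
      if (i, j) ∈ ferrers π then S.1 i j else if (i, j) ∈ ferrers b then n else 0 := rfl

theorem smallPtn_fillLargest {π : Ptn k} (hle : π ≤ b) (hs : IsHorizontalStrip b π)
    (hr : ∀ i : Fin k, (i : ℕ) < r → π.1 i = b.1 i) (S : Tableau (ferrers π) n) :
    smallPtn (fillLargest hle hs hr S) = π := by
  refine ext_of_mem_ferrers fun i j => ?_
  rw [mem_smallPtn, fillLargest_apply]
  constructor
  · rintro ⟨h1, h2⟩
    by_contra h3
    rw [if_neg h3, if_pos h1] at h2
    exact lt_irrefl _ h2
  · intro h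
    rw [if_pos h]
    exact ⟨(YoungDiagram.mem_cells _).1 (ferrers_mono hle ((YoungDiagram.mem_cells _).2 h)), S.2 _ _ h⟩

/-- The part of a tableau filled with entries smaller than `n`. -/
def eraseLargest {π : Ptn k} (T : RestrictedTableau (ferrers b) n r) (hT : smallPtn T = π) :
    Tableau (ferrers π) n :=
  have hmem : ∀ {i j : ℕ}, (i, j) ∈ ferrers π → (i, j) ∈ ferrers b ∧ T.1.1 i j < n :=
    fun {i j} h => (mem_smallPtn T i j).1 (hT.symm ▸ h)
  ⟨{ entry := fun i j => if (i, j) ∈ ferrers π then T.1.1 i j else 0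
     row_weak' := by
        intro i j1 j2 hj h
        rw [if_pos h, if_pos ((ferrers π).up_left_mem le_rfl hj.le h)]
        exact T.1.1.row_weak hj (hmem h).1
     col_strict' := by
        intro i1 i2 j hi h
        rw [if_pos h, if_pos ((ferrers π).up_left_mem hi.le le_rfl h)]
        exact T.1.1.col_strict hi (hmem h).1
     zeros' := fun h => if_neg h }, by
    intro i j h
    change (if (i, j) ∈ ferrers π then T.1.1 i j else 0) < n
    rw [if_pos h]
    exact (hmem h).2⟩

theorem eraseLargest_apply {π : Ptn k} (T : RestrictedTableau (ferrers b) n r)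
    (hT : smallPtn T = π) (i j : ℕ) :
    (eraseLargest T hT).1 i j = if (i, j) ∈ ferrers π then T.1.1 i j else 0 := rfl

variable {A : Type*} [CommRing A]

theorem weight_fillLargest {π : Ptn k} (hle : π ≤ b) (hs : IsHorizontalStrip b π)
    (hr : ∀ i : Fin k, (i : ℕ) < r → π.1 i = b.1 i) (S : Tableau (ferrers π) n)
    (x : Fin (n + 1) → A) :
    weight x (fillLargest hle hs hr S).1 =
      x (Fin.last n) ^ (skewCells b π).card * weight (fun i : Fin n => x i.castSucc) S := by
  rw [weight_eq_prod, weight_eq_prod, ← Finset.prod_sdiff (ferrers_mono hle)]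
  congr 1
  · rw [← Finset.prod_const]
    refine Finset.prod_congr rfl fun c hc => ?_
    have h := Finset.mem_sdiff.1 hc
    have h1 : (fillLargest hle hs hr S).1.1 c.1 c.2 = n := by
      rw [fillLargest_apply, if_neg (fun h' => h.2 ((YoungDiagram.mem_cells _).2 h')),
        if_pos ((YoungDiagram.mem_cells _).1 h.1)]
    simp only [h1, Nat.lt_succ_self, dif_pos]
    rfl
  · refine Finset.prod_congr rfl fun c hc => ?_
    have h : (c.1, c.2) ∈ ferrers π := (YoungDiagram.mem_cells _).1 hc
    have h1 : (fillLargest hle hs hr S).1.1 c.1 c.2 = S.1 c.1 c.2 := by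
      rw [fillLargest_apply, if_pos h]
    have h2 := S.2 _ _ h
    simp only [h1, h2, h2.trans (Nat.lt_succ_self n), dif_pos]
    rfl

open scoped Classical in
/-- Branching rule for tableaux whose largest letter avoids the first `r` rows. -/
theorem sum_restrictedTableau (b : Ptn k) (n r : ℕ) (x : Fin (n + 1) → A) :
    ∑ T : RestrictedTableau (ferrers b) n r, weight x T.1 =
      ∑ π : Strip b, if ∀ i : Fin k, (i : ℕ) < r → π.1.1 i = b.1 i then
        x (Fin.last n) ^ (skewCells b π.1).card * schur π.1 (fun i : Fin n => x i.castSucc)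
        else 0 := by
  -- Group the tableaux by the shape `π` of their entries below `n`. A fibre corresponds to the
  -- tableaux of shape `π` if `π` and `b` agree in the first `r` rows, and is empty otherwise.
  rw [← Finset.sum_fiberwise Finset.univ
    (fun T : RestrictedTableau (ferrers b) n r =>
      (⟨smallPtn T, smallPtn_le T, smallPtn_strip T⟩ : Strip b))]
  refine Finset.sum_congr rfl fun π _ => ?_
  split_ifs with hr
  · rw [schur, Finset.mul_sum]
    symm
    refine Finset.sum_bij' (fun S _ => fillLargest π.2.1 π.2.2 hr S)
      (fun T hT => eraseLargest T (congrArg Subtype.val (Finset.mem_filter.1 hT).2)) ?_ ?_ ?_ ?_ ?_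
    · intro S _
      exact Finset.mem_filter.2 ⟨Finset.mem_univ _, Subtype.ext (smallPtn_fillLargest _ _ _ _)⟩
    · intro T _
      exact Finset.mem_univ _
    · intro S _
      refine Subtype.ext (SemistandardYoungTableau.ext fun i j => ?_)
      rw [eraseLargest_apply, fillLargest_apply]
      split_ifs with h
      · rfl
      · exact (S.1.zeros h).symm
    · intro T hT
      have hT' : smallPtn T = π.1 := congrArg Subtype.val (Finset.mem_filter.1 hT).2
      refine Subtype.ext (Subtype.ext (SemistandardYoungTableau.ext fun i j => ?_))
      rw [fillLargest_apply, eraseLargest_apply]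
      split_ifs with h h1
      · rfl
      · have h2 := mem_smallPtn T i j
        rw [hT'] at h2
        have h3 := T.1.2 _ _ h1
        have h4 : ¬ T.1.1 i j < n := fun h5 => h (h2.2 ⟨h1, h5⟩)
        omega
      · exact (T.1.1.zeros h1).symm
    · intro S _
      exact (weight_fillLargest _ _ _ _ _).symm
  · refine Finset.sum_eq_zero fun T hT => absurd ?_ hr
    have hT' : smallPtn T = π.1 := congrArg Subtype.val (Finset.mem_filter.1 hT).2
    intro i hi
    rw [← hT']
    exact smallPtn_eq_of_lt T i hi

/-- Branching rule for Schur functions. -/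
theorem schur_succ (b : Ptn k) (x : Fin (n + 1) → A) :
    schur b x = ∑ π : Strip b,
      x (Fin.last n) ^ (skewCells b π.1).card * schur π.1 (fun i : Fin n => x i.castSucc) := by
  have h := sum_restrictedTableau b n 0 x
  simp only [Nat.not_lt_zero, false_imp_iff, implies_true, if_true] at h
  rw [← h, schur]
  exact Fintype.sum_equiv (Equiv.subtypeUnivEquiv (fun T i j _ _ => Nat.zero_le i)).symm _ _
    fun T => rfl

end Branching

theorem schur_zero_vars {A : Type*} [CommRing A] {k : ℕ} (a : Ptn k) (x : Fin 0 → A) :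
    schur a x = if ∀ i, a.1 i = 0 then 1 else 0 := by
  split_ifs with h
  · have hc : (ferrers a).cells = ∅ := by
      rw [← Finset.card_eq_zero, card_ferrers]
      exact Finset.sum_eq_zero fun i _ => h i
    have hno : ∀ i j : ℕ, (i, j) ∉ ferrers a := fun i j hij => by
      rw [← YoungDiagram.mem_cells, hc] at hij
      exact absurd hij (Finset.notMem_empty _)
    have huniq : ∀ T S : Tableau (ferrers a) 0, T = S := fun T S =>
      Subtype.ext (SemistandardYoungTableau.ext fun i j => by
        rw [T.1.zeros (hno i j), S.1.zeros (hno i j)])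
    let T₀ : Tableau (ferrers a) 0 :=
      ⟨SemistandardYoungTableau.highestWeight _, fun i j hij => absurd hij (hno i j)⟩
    rw [schur, Fintype.sum_eq_single T₀ fun T hT => absurd (huniq T T₀) hT, weight_eq_prod, hc,
      Finset.prod_empty]
  · push Not at h
    obtain ⟨i, hi⟩ := h
    refine Finset.sum_eq_zero fun T _ => ?_
    exact absurd (T.2 i 0 ((mem_ferrers _ _ _).2 ⟨i.2, Nat.pos_of_ne_zero hi⟩)) (Nat.not_lt_zero _)

theorem map_schur {A B : Type*} [CommRing A] [CommRing B] (f : A →+* B) {k n : ℕ} (a : Ptn k)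
    (x : Fin n → A) : f (schur a x) = schur a (fun i => f (x i)) := by
  simp only [schur, weight, map_sum, map_prod]

/-! ### Interlacing of zero-padded partitions -/

/-- The `i`-th part of a partition, `0` beyond its length. -/
def part {k : ℕ} (a : Ptn k) (i : ℕ) : ℕ := if h : i < k then a.1 ⟨i, h⟩ else 0

theorem part_of_lt {k : ℕ} (a : Ptn k) {i : ℕ} (h : i < k) : part a i = a.1 ⟨i, h⟩ := dif_pos h

theorem part_of_le {k : ℕ} (a : Ptn k) {i : ℕ} (h : k ≤ i) : part a i = 0 :=
  dif_neg (not_lt.mpr h)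

theorem part_val {k : ℕ} (a : Ptn k) (i : Fin k) : part a i = a.1 i := part_of_lt a i.2

theorem part_antitone {k : ℕ} (a : Ptn k) : Antitone (part a) := by
  intro i j hij
  by_cases hj : j < k
  · rw [part_of_lt a hj, part_of_lt a (lt_of_le_of_lt hij hj)]
    exact a.2 hij
  · rw [part_of_le a (not_lt.mp hj)]
    exact Nat.zero_le _

/-- Monotonicity reduces the strip condition to consecutive rows; zero padding makes it uniform at
the last row. -/
theorem strip_iff_part {k : ℕ} {lam π : Ptn k} :
    (π ≤ lam ∧ IsHorizontalStrip lam π) ↔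
      ∀ i, part lam (i + 1) ≤ part π i ∧ part π i ≤ part lam i := by
  rw [isHorizontalStrip_iff]
  constructor
  · rintro ⟨h1, h2⟩ i
    by_cases hi : i < k
    · constructor
      · by_cases hi' : i + 1 < k
        · rw [part_of_lt _ hi, part_of_lt _ hi']
          exact h2 _ _ (Nat.lt_succ_self i)
        · rw [part_of_le _ (not_lt.mp hi')]
          exact Nat.zero_le _
      · rw [part_of_lt _ hi, part_of_lt _ hi]
        exact h1 _
    · rw [part_of_le lam (by omega), part_of_le π (by omega)]
      exact ⟨Nat.zero_le _, Nat.zero_le _⟩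
  · intro h
    refine ⟨fun i => ?_, fun i j hij => ?_⟩
    · have := (h i).2
      rwa [part_val, part_val] at this
    · rw [← part_val, ← part_val]
      exact (part_antitone lam (Nat.succ_le_of_lt hij)).trans (h i).1

theorem card_skewCells_eq_sum_range {k : ℕ} {lam π : Ptn k} (h : π ≤ lam) {N : ℕ}
    (hN : ∀ i, N ≤ i → part lam i = 0) :
    (skewCells lam π).card = ∑ i ∈ Finset.range N, (part lam i - part π i) := by
  have h1 : (skewCells lam π).card = ∑ i ∈ Finset.range k, (part lam i - part π i) := by
    rw [card_skewCells h, Finset.sum_range]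
    exact Finset.sum_congr rfl fun i _ => by rw [part_val, part_val]
  rw [h1]
  rcases le_total k N with hk | hk
  · refine Finset.sum_subset (Finset.range_subset_range.2 hk) fun i _ hi => ?_
    rw [part_of_le lam (by simpa using hi), Nat.zero_sub]
  · symm
    refine Finset.sum_subset (Finset.range_subset_range.2 hk) fun i _ hi => ?_
    rw [hN i (by simpa using hi), Nat.zero_sub]

variable {A : Type*} [CommRing A]

/-- Interlacing shows that removing one letter costs at most one row, so a partition with more than
`n` parts is still nonzero when no letters remain. -/
theorem schur_eq_zero {k n : ℕ} (a : Ptn k) (x : Fin n → A) {i : ℕ} (hi : n ≤ i)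
    (ha : part a i ≠ 0) : schur a x = 0 := by
  induction n generalizing a i with
  | zero =>
    rw [schur_zero_vars, if_neg]
    intro h
    have hk : i < k := by
      by_contra hk
      exact ha (part_of_le a (not_lt.mp hk))
    exact ha (by rw [part_of_lt a hk, h])
  | succ n ih =>
    rw [schur_succ]
    refine Finset.sum_eq_zero fun π _ => ?_
    obtain ⟨j, rfl⟩ : ∃ j, i = j + 1 := ⟨i - 1, by omega⟩
    have h1 := (strip_iff_part.1 π.2 j).1
    rw [ih π.1 _ (i := j) (by omega) (by omega), mul_zero]

/-! ### Alternants and the bialternant formula -/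

/-- The alternant `det (x_i ^ e_j)`. -/
def alternant {ι : Type*} [Fintype ι] [DecidableEq ι] (x : ι → A) (e : ι → ℕ) : A :=
  (Matrix.of fun i j => x i ^ e j).det

theorem det_eq_of_forall_col_eq_smul_add_succ {n : ℕ} {M N : Matrix (Fin (n + 1)) (Fin (n + 1)) A}
    (c : Fin n → A) (hlast : ∀ i, M i (Fin.last n) = N i (Fin.last n))
    (hsucc : ∀ i (j : Fin n), M i j.castSucc = N i j.castSucc + c j * M i j.succ) :
    M.det = N.det := by
  rw [← Matrix.det_submatrix_equiv_self Fin.revPerm M,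
    ← Matrix.det_submatrix_equiv_self Fin.revPerm N]
  refine Matrix.det_eq_of_forall_col_eq_smul_add_pred (fun j => c j.rev) ?_ ?_
  · intro i
    simpa using hlast i.rev
  · intro i j
    simpa [Fin.rev_succ, Fin.rev_castSucc] using hsucc i.rev j.rev

/-- A finite geometric sum. The exponents between `q` and `p` later supply the interlacing
partitions. -/
theorem pow_sub_mul_pow_eq (u v : A) {p q : ℕ} (h : q ≤ p) :
    u ^ p - v ^ (p - q) * u ^ q =
      (u - v) * ∑ t ∈ Finset.Ico q p, v ^ (p - 1 - t) * u ^ t := by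
  obtain ⟨d, rfl⟩ := Nat.exists_eq_add_of_le h
  rw [Finset.sum_Ico_eq_sum_range, Nat.add_sub_cancel_left]
  have h1 : ∑ t ∈ Finset.range d, v ^ (q + d - 1 - (q + t)) * u ^ (q + t) =
      u ^ q * ∑ t ∈ Finset.range d, u ^ t * v ^ (d - 1 - t) := by
    rw [Finset.mul_sum]
    refine Finset.sum_congr rfl fun t _ => ?_
    rw [show q + d - 1 - (q + t) = d - 1 - t by omega, pow_add]
    ring
  rw [h1, mul_left_comm, mul_comm (u - v), (Commute.all u v).geom_sum₂_mul, pow_add]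
  ring

/-- Expansion of an alternant in `n + 1` variables in terms of alternants in `n` variables. -/
theorem alternant_succ {n : ℕ} (x : Fin (n + 1) → A) (m : Fin (n + 1) → ℕ) (hm : Antitone m) :
    alternant x m = x (Fin.last n) ^ m (Fin.last n) *
      ((∏ i : Fin n, (x i.castSucc - x (Fin.last n))) *
        ∑ t ∈ Fintype.piFinset fun j : Fin n => Finset.Ico (m j.succ) (m j.castSucc),
          (∏ j, x (Fin.last n) ^ (m j.castSucc - 1 - t j)) *
            alternant (fun i : Fin n => x i.castSucc) t) := by
  set y := x (Fin.last n) with hy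
  -- Subtract from each column the multiple of the next one that kills its entry in the last row.
  let N : Matrix (Fin (n + 1)) (Fin (n + 1)) A := Matrix.of fun i =>
    Fin.snoc (fun j : Fin n => x i ^ m j.castSucc - y ^ (m j.castSucc - m j.succ) * x i ^ m j.succ)
      (x i ^ m (Fin.last n))
  have hle : ∀ j : Fin n, m j.succ ≤ m j.castSucc := fun j => hm j.castSucc_lt_succ.le
  have h1 : alternant x m = N.det := by
    refine det_eq_of_forall_col_eq_smul_add_succ
      (fun j => y ^ (m j.castSucc - m j.succ)) (fun i => ?_) (fun i j => ?_)
    · simp [N]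
    · simp [N]
  rw [h1, Matrix.det_succ_row N (Fin.last n), Fin.sum_univ_castSucc]
  have h0 : ∀ j : Fin n, N (Fin.last n) j.castSucc = 0 := fun j => by
    simp only [N, Matrix.of_apply, Fin.snoc_castSucc, ← hy]
    rw [← pow_add, Nat.sub_add_cancel (hle j), sub_self]
  rw [Finset.sum_eq_zero fun j _ => by rw [h0, mul_zero, zero_mul], zero_add]
  have h2 : N (Fin.last n) (Fin.last n) = y ^ m (Fin.last n) := by simp [N, hy]
  rw [h2, ← two_mul, pow_mul, neg_one_sq, one_pow, one_mul]
  congr 1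
  have h3 : N.submatrix (Fin.last n).succAbove (Fin.last n).succAbove =
      Matrix.of fun i j : Fin n => (x i.castSucc - y) *
        (Matrix.of fun i j : Fin n => ∑ t ∈ Finset.Ico (m j.succ) (m j.castSucc),
          y ^ (m j.castSucc - 1 - t) * x i.castSucc ^ t) i j := by
    ext i j
    simp only [N, Matrix.submatrix_apply, Matrix.of_apply, Fin.succAbove_last, Fin.snoc_castSucc]
    exact pow_sub_mul_pow_eq _ _ (hle j)
  rw [h3, Matrix.det_mul_column]
  congr 1
  rw [← Matrix.det_transpose]
  -- After transposition each row is a sum over `t`, and multilinearity expands the determinant.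
  have h4 : (Matrix.of fun i j : Fin n => ∑ t ∈ Finset.Ico (m j.succ) (m j.castSucc),
          y ^ (m j.castSucc - 1 - t) * x i.castSucc ^ t).transpose =
      fun j => ∑ t ∈ Finset.Ico (m j.succ) (m j.castSucc),
        fun i => y ^ (m j.castSucc - 1 - t) * x i.castSucc ^ t := by
    ext i j
    simp [Matrix.transpose_apply]
  rw [h4]
  refine (Matrix.detRowAlternating.toMultilinearMap.map_sum_finset
    (fun (j : Fin n) t (i : Fin n) => y ^ (m j.castSucc - 1 - t) * x i.castSucc ^ t)
    fun j => Finset.Ico (m j.succ) (m j.castSucc)).trans ?_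
  refine Finset.sum_congr rfl fun t _ => ?_
  rw [alternant, ← Matrix.det_transpose, ← Matrix.det_mul_column]
  rfl

/-- The staircase `(n - 1, …, 1, 0)`. -/
def staircase (n : ℕ) (j : Fin n) : ℕ := n - 1 - j

theorem staircase_antitone (n : ℕ) : Antitone (staircase n) :=
  fun _ _ h => Nat.sub_le_sub_left h _

/-- Consecutive staircase exponents differ by one, so each interval contains a single exponent. -/
theorem alternant_staircase_succ {n : ℕ} (x : Fin (n + 1) → A) :
    alternant x (staircase (n + 1)) = (∏ i : Fin n, (x i.castSucc - x (Fin.last n))) *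
      alternant (fun i : Fin n => x i.castSucc) (staircase n) := by
  rw [alternant_succ x _ (staircase_antitone _)]
  have h1 : (Fintype.piFinset fun j : Fin n => Finset.Ico (staircase (n + 1) j.succ)
      (staircase (n + 1) j.castSucc)) = {staircase n} := by
    rw [← Fintype.piFinset_singleton]
    congr 1
    ext j t
    simp only [staircase, Finset.mem_Ico, Finset.mem_singleton, Fin.val_succ, Fin.val_castSucc]
    omega
  rw [h1, Finset.sum_singleton]
  have h2 : ∀ j : Fin n, staircase (n + 1) j.castSucc - 1 - staircase n j = 0 := fun j => by
    simp only [staircase, Fin.val_castSucc]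
    omega
  have h3 : staircase (n + 1) (Fin.last n) = 0 := by simp [staircase]
  simp [h2, h3]

/-- The bialternant formula. -/
theorem alternant_mul_schur {k n : ℕ} (a : Ptn k) (x : Fin n → A)
    (ha : ∀ i, n ≤ i → part a i = 0) :
    alternant x (staircase n) * schur a x = alternant x fun j => part a j + staircase n j := by
  induction n generalizing a with
  | zero =>
    rw [schur_zero_vars, if_pos fun i => by rw [← part_val, ha i (Nat.zero_le _)]]
    simp [alternant]
  | succ n ih =>
    rw [alternant_staircase_succ, schur_succ, alternant_succ x _ fun i j h =>
      Nat.add_le_add (part_antitone a h) (staircase_antitone _ h), mul_assoc,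
      mul_left_comm (x (Fin.last n) ^ _)]
    congr 1
    rw [Finset.mul_sum, Finset.mul_sum]
    set y := x (Fin.last n)
    classical
    -- Only the `π` with at most `n` parts contribute; these match the exponents `t` through `t_j =
    -- π_j + (n - 1 - j)`.
    rw [← Finset.sum_filter_of_ne (p := fun π : Strip a => ∀ i, n ≤ i → part π.1 i = 0)]
    swap
    · intro π _ hπ i hi
      by_contra hne
      exact hπ (by rw [schur_eq_zero _ _ hi hne, mul_zero, mul_zero])
    -- The exponent intervals are the interlacing conditions shifted by the staircase; `n - 1 - j ≤
    -- t j` makes the truncated subtraction exact.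
    have hmem : ∀ t : Fin n → ℕ, (t ∈ Fintype.piFinset fun j : Fin n => Finset.Ico
        (part a (j.succ : Fin (n + 1)) + staircase (n + 1) j.succ)
        (part a (j.castSucc : Fin (n + 1)) + staircase (n + 1) j.castSucc)) ↔
        ∀ j : Fin n, part a (j + 1) ≤ t j - (n - 1 - j) ∧ t j - (n - 1 - j) ≤ part a j ∧
          n - 1 - j ≤ t j := by
      intro t
      rw [Fintype.mem_piFinset]
      refine forall_congr' fun j => ?_
      simp only [staircase, Finset.mem_Ico, Fin.val_succ, Fin.val_castSucc]
      omega
    refine Finset.sum_bij' (fun π _ => fun j : Fin n => part π.1 j + staircase n j)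
      (fun t ht => ⟨⟨fun i => if h : (i : ℕ) < n then t ⟨i, h⟩ - (n - 1 - i) else 0, ?_⟩, ?_⟩)
      ?_ ?_ ?_ ?_ ?_
    · have ht' := (hmem t).1 ht
      intro i j hij
      rcases hij.eq_or_lt with rfl | hlt
      · exact le_rfl
      dsimp only
      split_ifs with h1 h2
      · have e1 := (ht' ⟨j, h1⟩).2.1
        have e2 := (ht' ⟨i, h2⟩).1
        have e3 := part_antitone a (Nat.succ_le_of_lt (Fin.lt_def.1 hlt))
        exact e1.trans (e3.trans e2)
      · have := Fin.lt_def.1 hlt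
        omega
      · exact Nat.zero_le _
      · exact le_rfl
    · have ht' := (hmem t).1 ht
      refine ⟨fun i => ?_, isHorizontalStrip_iff.2 fun i j hij => ?_⟩
      · dsimp only
        split_ifs with h1
        · rw [← part_val]
          exact (ht' ⟨i, h1⟩).2.1
        · exact Nat.zero_le _
      · dsimp only
        rw [← part_val]
        have h2 := part_antitone a (Nat.succ_le_of_lt (Fin.lt_def.1 hij))
        split_ifs with h1
        · exact h2.trans (ht' ⟨i, h1⟩).1
        · exact (ha j (by have := Fin.lt_def.1 hij; omega)).le
    · intro π hπ
      rw [hmem]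
      intro j
      have := strip_iff_part.1 π.2 j
      simp only [staircase]
      omega
    · intro t ht
      refine Finset.mem_filter.2 ⟨Finset.mem_univ _, fun i hi => ?_⟩
      by_cases hk : i < k
      · rw [part_of_lt _ hk]
        exact dif_neg (not_lt.mpr hi)
      · exact part_of_le _ (not_lt.mp hk)
    · intro π hπ
      have h0 := (Finset.mem_filter.1 hπ).2
      refine Subtype.ext (Subtype.ext (funext fun i => ?_))
      dsimp only
      split_ifs with h
      · simp only [staircase]
        rw [Nat.add_sub_cancel, part_val]
      · rw [← part_val, h0 i (not_lt.mp h)]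
    · intro t ht
      have ht' := (hmem t).1 ht
      funext j
      have h1 := ht' j
      by_cases hk : (j : ℕ) < k
      · rw [part_of_lt _ hk]
        simp only [staircase, j.2, dif_pos, Fin.eta]
        omega
      · rw [part_of_le _ (not_lt.mp hk), staircase]
        rw [part_of_le a (not_lt.mp hk)] at h1
        omega
    · intro π hπ
      have h0 := (Finset.mem_filter.1 hπ).2
      -- The summand `part a n` is the power of `y` that was split off in front of the sum.
      have hcard : (skewCells a π.1).card = part a n +
          ∑ j : Fin n, (part a (j.castSucc : Fin (n + 1)) + staircase (n + 1) j.castSucc - 1 -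
            (part π.1 j + staircase n j)) := by
        rw [card_skewCells_eq_sum_range π.2.1 ha, Finset.sum_range_succ, h0 n le_rfl, add_comm,
          Nat.sub_zero, Finset.sum_range]
        congr 1
        refine Finset.sum_congr rfl fun j _ => ?_
        have := j.2
        simp only [staircase, Fin.val_castSucc]
        omega
      rw [← ih π.1 _ h0, Finset.prod_pow_eq_pow_sum, hcard, pow_add]
      simp only [staircase, Fin.val_last]
      simp
      ring

theorem alternant_staircase_ne_zero [IsDomain A] {n : ℕ} (x : Fin n → A)
    (hx : Function.Injective x) : alternant x (staircase n) ≠ 0 := by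
  induction n with
  | zero => simp [alternant]
  | succ n ih =>
    rw [alternant_staircase_succ]
    refine mul_ne_zero (Finset.prod_ne_zero_iff.2 fun i _ => sub_ne_zero.2 fun h => ?_)
      (ih _ fun i j h => Fin.castSucc_injective n (hx h))
    exact (Fin.castSucc_lt_last i).ne (hx h)

/-! ### Symmetry of Schur functions -/

theorem alternant_comp_perm {ι : Type*} [Fintype ι] [DecidableEq ι] (x : ι → A) (e : ι → ℕ)
    (σ : Equiv.Perm ι) :
    alternant (fun i => x (σ i)) e = ((Equiv.Perm.sign σ : ℤ) : A) * alternant x e :=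
  Matrix.det_permute σ (Matrix.of fun i j => x i ^ e j)

/-- Both alternants in the bialternant formula change by the same sign. Cancelling the Vandermonde
determinant needs independent variables over a domain, so this is done in `ℤ[X]` and then
specialized. -/
theorem schur_comp_perm {k n : ℕ} (a : Ptn k) (x : Fin n → A) (σ : Equiv.Perm (Fin n)) :
    schur a (fun i => x (σ i)) = schur a x := by
  by_cases ha : ∀ i, n ≤ i → part a i = 0
  · have key : schur a (fun i => (MvPolynomial.X (σ i) : MvPolynomial (Fin n) ℤ)) =
        schur a MvPolynomial.X := by
      have h1 := alternant_mul_schur a (MvPolynomial.X : Fin n → MvPolynomial (Fin n) ℤ) ha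
      have h2 := alternant_mul_schur a
        (fun i => (MvPolynomial.X (σ i) : MvPolynomial (Fin n) ℤ)) ha
      rw [alternant_comp_perm, alternant_comp_perm, ← h1, mul_assoc] at h2
      have hs : ((Equiv.Perm.sign σ : ℤ) : MvPolynomial (Fin n) ℤ) ≠ 0 := by
        rcases Int.units_eq_one_or (Equiv.Perm.sign σ) with h | h <;> simp [h]
      exact mul_left_cancel₀
        (alternant_staircase_ne_zero _ (MvPolynomial.X_injective)) (mul_left_cancel₀ hs h2)
    have h := congrArg (MvPolynomial.eval₂Hom (Int.castRingHom A) x) key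
    simpa only [map_schur, MvPolynomial.coe_eval₂Hom, MvPolynomial.eval₂_X] using h
  · push Not at ha
    obtain ⟨i, hi, h⟩ := ha
    rw [schur_eq_zero a _ hi h, schur_eq_zero a _ hi h]

theorem schur_comp_equiv {k n m : ℕ} (a : Ptn k) (x : Fin m → A) (e : Fin n ≃ Fin m) :
    schur a (fun i => x (e i)) = schur a x := by
  obtain rfl : n = m := by simpa using Fintype.card_congr e
  exact schur_comp_perm a x e

theorem schur_snoc {k n : ℕ} (b : Ptn k) (u : Fin n → A) (y : A) :
    schur b (Fin.snoc u y : Fin (n + 1) → A) = ∑ π : Strip b,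
      y ^ (skewCells b π.1).card * schur π.1 u := by
  rw [schur_succ]
  simp only [Fin.snoc_last, Fin.snoc_castSucc]

/-! ### Complements in a box and splitting of the alphabet -/

section Box

variable {k g : ℕ}

/-- Rotated complementation in the rectangle `(g^k)`. -/
def complBox (k g : ℕ) : InBox k g ≃ InBox k g :=
  have hinv : Function.Involutive fun lam : InBox k g =>
      (⟨rotCompl lam, fun _ => Nat.sub_le _ _⟩ : InBox k g) := fun lam => by
    refine Subtype.ext (Subtype.ext (funext fun i => ?_))
    have : lam.1.1 i ≤ g := lam.2 i
    simp only [rotCompl, Fin.rev_rev]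
    omega
  hinv.toPerm

theorem complBox_apply (lam : InBox k g) (i : Fin k) :
    (complBox k g lam).1.1 i = g - lam.1.1 i.rev := rfl

theorem complBox_val (lam : InBox k g) : (complBox k g lam).1 = rotCompl lam := rfl

theorem complBox_complBox (lam : InBox k g) : complBox k g (complBox k g lam) = lam :=
  (complBox k g).symm_apply_apply lam

/-- Complementation reverses all the interlacing inequalities, and rotation reverses the order of
the rows. -/
theorem strip_complBox {lam π : InBox k g} (h : π.1 ≤ lam.1 ∧ IsHorizontalStrip lam.1 π.1) :
    (complBox k g lam).1 ≤ (complBox k g π).1 ∧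
      IsHorizontalStrip (complBox k g π).1 (complBox k g lam).1 := by
  refine ⟨fun i => Nat.sub_le_sub_left (h.1 _) _, isHorizontalStrip_iff.2 fun i j hij => ?_⟩
  exact Nat.sub_le_sub_left (isHorizontalStrip_iff.1 h.2 _ _ (Fin.rev_lt_rev.2 hij)) _

theorem strip_complBox_iff (lam π : InBox k g) :
    ((complBox k g lam).1 ≤ (complBox k g π).1 ∧
      IsHorizontalStrip (complBox k g π).1 (complBox k g lam).1) ↔
      (π.1 ≤ lam.1 ∧ IsHorizontalStrip lam.1 π.1) := by
  refine ⟨fun h => ?_, strip_complBox⟩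
  have := strip_complBox h
  rwa [complBox_complBox, complBox_complBox] at this

theorem card_skewCells_complBox {lam π : InBox k g} (h : π.1 ≤ lam.1) :
    (skewCells (complBox k g π).1 (complBox k g lam).1).card = (skewCells lam.1 π.1).card := by
  rw [card_skewCells h, card_skewCells fun i => Nat.sub_le_sub_left (h _) _]
  refine Fintype.sum_equiv Fin.revPerm _ _ fun i => ?_
  have h1 : π.1.1 i.rev ≤ lam.1.1 i.rev := h _
  have h2 : lam.1.1 i.rev ≤ g := lam.2 _
  simp only [complBox_apply, Fin.revPerm_apply]
  omega

open scoped Classical in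
-- Makes the index set independent of `lam`, so that sums over `lam` and `π` can be interchanged.
theorem sum_strip_eq_sum_inBox (lam : InBox k g) (f : Ptn k → A) :
    ∑ π : Strip lam.1, f π.1 =
      ∑ π : InBox k g, if π.1 ≤ lam.1 ∧ IsHorizontalStrip lam.1 π.1 then f π.1 else 0 := by
  rw [← Finset.sum_filter]
  refine Finset.sum_bij' (fun π _ => ⟨π.1, π.2.1.trans lam.2⟩)
    (fun π hπ => ⟨π.1, (Finset.mem_filter.1 hπ).2⟩) ?_ ?_ ?_ ?_ ?_
  · exact fun π _ => Finset.mem_filter.2 ⟨Finset.mem_univ _, π.2⟩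
  · exact fun _ _ => Finset.mem_univ _
  · exact fun _ _ => rfl
  · exact fun _ _ => rfl
  · exact fun _ _ => rfl

/-- Branching on `y` turns both sides into one double sum, over horizontal strips `lam/π` in the
box, of `y^{|lam/π|}` times the Schur functions of the complement of `lam` in `u` and of `π` in `v`.
A letter may thus change blocks. -/
theorem sum_complBox_snoc {m n : ℕ} (u : Fin m → A) (v : Fin n → A) (y : A) :
    ∑ π : InBox k g, schur (complBox k g π).1 (Fin.snoc u y : Fin (m + 1) → A) * schur π.1 v =
      ∑ lam : InBox k g, schur (complBox k g lam).1 u *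
        schur lam.1 (Fin.snoc v y : Fin (n + 1) → A) := by
  classical
  simp only [schur_snoc]
  have hl : ∀ π : InBox k g, (∑ ρ : Strip (complBox k g π).1,
      y ^ (skewCells (complBox k g π).1 ρ.1).card * schur ρ.1 u) =
      ∑ lam : InBox k g, if π.1 ≤ lam.1 ∧ IsHorizontalStrip lam.1 π.1 then
        y ^ (skewCells lam.1 π.1).card * schur (complBox k g lam).1 u else 0 := by
    intro π
    rw [sum_strip_eq_sum_inBox (complBox k g π)
      fun ρ => y ^ (skewCells (complBox k g π).1 ρ).card * schur ρ u]
    symm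
    refine Fintype.sum_equiv (complBox k g) _ _ fun lam => ?_
    by_cases h : π.1 ≤ lam.1 ∧ IsHorizontalStrip lam.1 π.1
    · rw [if_pos h, if_pos ((strip_complBox_iff _ _).2 h), card_skewCells_complBox h.1]
    · rw [if_neg h, if_neg (mt (strip_complBox_iff _ _).1 h)]
  have hr : ∀ lam : InBox k g, (∑ ρ : Strip lam.1,
      y ^ (skewCells lam.1 ρ.1).card * schur ρ.1 v) =
      ∑ π : InBox k g, if π.1 ≤ lam.1 ∧ IsHorizontalStrip lam.1 π.1 then
        y ^ (skewCells lam.1 π.1).card * schur π.1 v else 0 := fun lam =>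
    sum_strip_eq_sum_inBox lam fun ρ => y ^ (skewCells lam.1 ρ).card * schur ρ v
  simp only [hl, hr, Finset.sum_mul, Finset.mul_sum]
  rw [Finset.sum_comm]
  refine Finset.sum_congr rfl fun lam _ => Finset.sum_congr rfl fun π _ => ?_
  split_ifs
  · ring
  · ring

/-- Moving the last letter of the second alphabet to the end of the first one. -/
def moveLast (m n : ℕ) : Fin m ⊕ Fin (n + 1) ≃ Fin (m + 1) ⊕ Fin n :=
  ((Equiv.refl _).sumCongr (finSumFinEquiv.symm.trans (Equiv.sumComm (Fin n) (Fin 1)))).trans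
    ((Equiv.sumAssoc _ _ _).symm.trans (finSumFinEquiv.sumCongr (Equiv.refl _)))

theorem elim_snoc_moveLast {B : Type*} {m n : ℕ} (u : Fin m → B) (v : Fin n → B) (y : B)
    (i : Fin m ⊕ Fin (n + 1)) :
    Sum.elim (Fin.snoc u y : Fin (m + 1) → B) v (moveLast m n i) =
      Sum.elim u (Fin.snoc v y : Fin (n + 1) → B) i := by
  rcases i with i | i
  · exact Fin.snoc_castSucc (α := fun _ => B) y u i
  · induction i using Fin.lastCases with
    | last =>
      have h : (finSumFinEquiv.symm (Fin.last n) : Fin n ⊕ Fin 1) = Sum.inr 0 :=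
        finSumFinEquiv_symm_last
      simp only [moveLast, Equiv.trans_apply, Equiv.sumCongr_apply, Sum.map_inr, h,
        Equiv.sumComm_apply, Sum.swap_inr, Equiv.sumAssoc_symm_apply_inr_inl, Sum.map_inl,
        Sum.elim_inl, Sum.elim_inr, Fin.snoc_last]
      exact Fin.snoc_last (α := fun _ => B) y u
    | cast i =>
      have h : (finSumFinEquiv.symm (Fin.castSucc i) : Fin n ⊕ Fin 1) = Sum.inl i :=
        finSumFinEquiv_symm_apply_castAdd i
      simp only [moveLast, Equiv.trans_apply, Equiv.sumCongr_apply, Sum.map_inr, h,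
        Equiv.sumComm_apply, Sum.swap_inl, Equiv.sumAssoc_symm_apply_inr_inr,
        Sum.elim_inr, Fin.snoc_castSucc, Equiv.coe_refl, id]

/-- Splitting the alphabet of a rectangular Schur function. -/
theorem sum_complBox {m n N : ℕ} (u : Fin m → A) (v : Fin n → A) (e : Fin N ≃ Fin m ⊕ Fin n) :
    ∑ π : InBox k g, schur (complBox k g π).1 u * schur π.1 v =
      schur (rect k g) fun i => Sum.elim u v (e i) := by
  induction n generalizing m with
  | zero =>
    -- With no letters in the second block only the empty `π` survives, and its complement is the
    -- whole rectangle.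
    rw [Fintype.sum_eq_single (⟨⟨fun _ => 0, fun _ _ _ => le_rfl⟩, fun _ => Nat.zero_le _⟩ :
      InBox k g)]
    · rw [schur_zero_vars, if_pos fun _ => rfl, mul_one]
      refine (schur_comp_equiv _ _ (e.trans (Equiv.sumEmpty (Fin m) (Fin 0)))).symm.trans ?_
      congr 1
      funext i
      simp only [Equiv.trans_apply]
      rcases e i with j | j
      · rfl
      · exact j.elim0
    · intro π hπ
      rw [schur_zero_vars, if_neg, mul_zero]
      exact fun h => hπ (Subtype.ext (Subtype.ext (funext h)))
  | succ n ih =>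
    obtain ⟨w, y, rfl⟩ : ∃ (w : Fin n → A) (y : A), v = (Fin.snoc w y : Fin (n + 1) → A) :=
      ⟨Fin.init v, v (Fin.last n), (Fin.snoc_init_self v).symm⟩
    rw [← sum_complBox_snoc, ih _ _ (e.trans (moveLast m n))]
    simp only [Equiv.trans_apply, elim_snoc_moveLast]

theorem schur_rect_snoc {m n : ℕ} (w : Fin m ⊕ Fin n → A) (y : A) (k g : ℕ)
    {N : ℕ} (e : Fin N ≃ Fin m ⊕ Fin n) :
    schur (rect k g) (Fin.snoc (fun i => w (e i)) y : Fin (N + 1) → A) =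
      ∑ lam : InBox k g, ∑ π : Strip lam.1, y ^ (skewCells lam.1 π.1).card *
        (schur (rotCompl lam) (fun i => w (Sum.inl i)) *
          schur π.1 fun i => w (Sum.inr i)) := by
  have h := sum_complBox (k := k) (g := g) (fun i => w (Sum.inl i))
    (Fin.snoc (fun i => w (Sum.inr i)) y : Fin (n + 1) → A)
    ((finSumFinEquiv (m := N) (n := 1)).symm.trans
      ((e.sumCongr (Equiv.refl (Fin 1))).trans ((Equiv.sumAssoc _ _ _).trans
        ((Equiv.refl (Fin m)).sumCongr finSumFinEquiv))))
  simp only [schur_snoc, Finset.mul_sum] at h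
  simp only [complBox_val, mul_left_comm (schur (rotCompl _) _)] at h
  rw [h]
  congr 1
  funext i
  induction i using Fin.lastCases with
  | last =>
    have h : (finSumFinEquiv.symm (Fin.last N) : Fin N ⊕ Fin 1) = Sum.inr 0 :=
      finSumFinEquiv_symm_last
    simp only [Equiv.trans_apply, h, Fin.snoc_last]
    exact (Fin.snoc_last (α := fun _ => A) y (fun i => w (Sum.inr i))).symm
  | cast i =>
    have h : (finSumFinEquiv.symm (Fin.castSucc i) : Fin N ⊕ Fin 1) = Sum.inl i :=
      finSumFinEquiv_symm_apply_castAdd i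
    simp only [Equiv.trans_apply, h, Fin.snoc_castSucc, Equiv.sumCongr_apply, Sum.map_inl]
    rcases e i with j | j
    · rfl
    · exact (Fin.snoc_castSucc (α := fun _ => A) y (fun i => w (Sum.inr i)) j).symm

end Box

/-! ### Laplace expansion by antisymmetrization -/

section Laplace

/-- Expand both alternants over permutations `τ`, `υ` of the blocks and absorb these into `σ`: each
pair then yields the full alternant once. -/
theorem sum_perm_alternant_mul {ι κ : Type*} [Fintype ι] [DecidableEq ι] [Fintype κ]
    [DecidableEq κ] (p : ι → ℕ) (q : κ → ℕ) (w : ι ⊕ κ → A) :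
    ∑ σ : Equiv.Perm (ι ⊕ κ), ((Equiv.Perm.sign σ : ℤ) : A) *
        (alternant (fun i => w (σ (Sum.inl i))) p * alternant (fun j => w (σ (Sum.inr j))) q) =
      ((Fintype.card ι).factorial * (Fintype.card κ).factorial : ℕ) *
        alternant w (Sum.elim p q) := by
  have h1 : ∀ σ : Equiv.Perm (ι ⊕ κ), ((Equiv.Perm.sign σ : ℤ) : A) *
      (alternant (fun i => w (σ (Sum.inl i))) p * alternant (fun j => w (σ (Sum.inr j))) q) =
      ∑ τ : Equiv.Perm ι, ∑ υ : Equiv.Perm κ,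
        ((Equiv.Perm.sign (σ * Equiv.sumCongr τ υ) : ℤ) : A) *
          ∏ s, w ((σ * Equiv.sumCongr τ υ) s) ^ Sum.elim p q s := by
    intro σ
    simp only [alternant, Matrix.det_apply', Matrix.of_apply]
    rw [Finset.sum_mul_sum, Finset.mul_sum]
    refine Finset.sum_congr rfl fun τ _ => ?_
    rw [Finset.mul_sum]
    refine Finset.sum_congr rfl fun υ _ => ?_
    rw [Fintype.prod_sum_type, Equiv.Perm.sign_mul, Equiv.Perm.sign_sumCongr]
    simp only [Equiv.Perm.mul_apply, Equiv.sumCongr_apply, Sum.map_inl, Sum.map_inr, Sum.elim_inl,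
      Sum.elim_inr, Units.val_mul, Int.cast_mul]
    ring
  have h2 : ∀ ρ : Equiv.Perm (ι ⊕ κ), ∑ σ : Equiv.Perm (ι ⊕ κ),
      ((Equiv.Perm.sign (σ * ρ) : ℤ) : A) * ∏ s, w ((σ * ρ) s) ^ Sum.elim p q s =
      alternant w (Sum.elim p q) := by
    intro ρ
    rw [alternant, Matrix.det_apply']
    exact Fintype.sum_equiv (Equiv.mulRight ρ) _ _ fun σ => rfl
  simp only [h1]
  rw [Finset.sum_comm]
  simp only [Finset.sum_comm (s := (Finset.univ : Finset (Equiv.Perm (ι ⊕ κ)))), h2]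
  simp only [Finset.sum_const, Finset.card_univ, Fintype.card_perm, nsmul_eq_mul, Nat.cast_mul]
  ring

theorem alternant_comp_equiv {ι κ : Type*} [Fintype ι] [DecidableEq ι] [Fintype κ]
    [DecidableEq κ] (w : κ → A) (p : κ → ℕ) (e : ι ≃ κ) :
    alternant (fun i => w (e i)) (fun i => p (e i)) = alternant w p :=
  Matrix.det_submatrix_equiv_self e (Matrix.of fun i j => w i ^ p j)

theorem alternant_add_const {ι : Type*} [Fintype ι] [DecidableEq ι] (w : ι → A) (p : ι → ℕ)
    (c : ℕ) : alternant w (fun j => c + p j) = (∏ i, w i) ^ c * alternant w p := by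
  rw [alternant, alternant, ← Finset.prod_pow, ← Matrix.det_mul_column]
  simp only [Matrix.of_apply, pow_add]

/-- The product of the two Vandermonde determinants of the alphabet `w`, split into two parts, and
of a power of the product of the first part. -/
def splitFactor {m n : ℕ} (g : ℕ) (w : Fin m ⊕ Fin n → A) : A :=
  (∏ i, w (Sum.inl i)) ^ (g + n) * alternant (fun i => w (Sum.inl i)) (staircase m) *
    alternant (fun j => w (Sum.inr j)) (staircase n)

/-- The antisymmetrization of `splitFactor` times a function of the alphabet. -/
def antisymm {m n : ℕ} (g : ℕ) (w : Fin m ⊕ Fin n → A) (f : (Fin m ⊕ Fin n → A) → A) : A :=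
  ∑ σ : Equiv.Perm (Fin m ⊕ Fin n), ((Equiv.Perm.sign σ : ℤ) : A) *
    (splitFactor g (fun s => w (σ s)) * f (fun s => w (σ s)))

/-- Laplace expansion of a Schur function along the first `m` rows. -/
theorem antisymm_schur_mul_schur {m n k l K : ℕ} {g : ℕ} (w : Fin m ⊕ Fin n → A) (lam : Ptn k)
    (π : Ptn l) (μ : Ptn K) (hlam : ∀ i, m ≤ i → part lam i = 0)
    (h1 : ∀ i, i < m → part μ i = g + part lam i) (h2 : ∀ i, part μ (m + i) = part π i) :
    antisymm g w (fun v => schur lam (fun i => v (Sum.inl i)) * schur π fun j => v (Sum.inr j)) =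
      (m.factorial * n.factorial : ℕ) *
        alternant (fun i => w (finSumFinEquiv.symm i)) (staircase (m + n)) *
        schur μ fun i => w (finSumFinEquiv.symm i) := by
  by_cases hπ : ∀ i, n ≤ i → part π i = 0
  · have hμ : ∀ i, m + n ≤ i → part μ i = 0 := fun i hi => by
      obtain ⟨j, rfl⟩ := Nat.exists_eq_add_of_le (show m ≤ i by omega)
      rw [h2, hπ j (by omega)]
    -- In the power `g + n`, the `g` is added to the parts of `lam`, and the `n` raises the
    -- staircase of length `m` to the first `m` entries of that of length `m + n`.
    have hf : ∀ v : Fin m ⊕ Fin n → A, splitFactor g v *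
        (schur lam (fun i => v (Sum.inl i)) * schur π fun j => v (Sum.inr j)) =
        alternant (fun i => v (Sum.inl i)) (fun j => g + n + (part lam j + staircase m j)) *
          alternant (fun j => v (Sum.inr j)) (fun j => part π j + staircase n j) := by
      intro v
      rw [alternant_add_const, ← alternant_mul_schur _ _ hlam, ← alternant_mul_schur _ _ hπ,
        splitFactor]
      ring
    rw [antisymm]
    simp only [hf]
    rw [sum_perm_alternant_mul, mul_assoc, alternant_mul_schur _ _ hμ, Fintype.card_fin,
      Fintype.card_fin, ← alternant_comp_equiv w _ finSumFinEquiv.symm]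
    congr 2
    funext i
    refine Fin.addCases (fun i => ?_) (fun i => ?_) i
    · have := i.2
      simp only [finSumFinEquiv_symm_apply_castAdd, Sum.elim_inl, Fin.val_castAdd, h1 _ i.2,
        staircase]
      omega
    · simp only [finSumFinEquiv_symm_apply_natAdd, Sum.elim_inr, Fin.val_natAdd, h2, staircase]
      omega
  -- If `π` has more than `n` parts, then `μ` has more than `m + n`, and both sides vanish.
  · push Not at hπ
    obtain ⟨i, hi, h⟩ := hπ
    rw [schur_eq_zero μ _ (Nat.add_le_add_left hi m) (by rwa [h2]), mul_zero, antisymm]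
    refine Finset.sum_eq_zero fun σ _ => ?_
    simp only [schur_eq_zero π _ hi h, mul_zero]

end Laplace

theorem schur_eq_one {k n : ℕ} (a : Ptn k) (x : Fin n → A) (ha : ∀ i, a.1 i = 0) :
    schur a x = 1 := by
  induction n with
  | zero => rw [schur_zero_vars, if_pos ha]
  | succ n ih =>
    have hsub : ∀ π : Strip a, π = ⟨a, le_rfl, isHorizontalStrip_iff.2 fun i j h => a.2 h.le⟩ :=
      fun π => Subtype.ext (Subtype.ext (funext fun i => by
        have h1 : π.1.1 i ≤ a.1 i := π.2.1 i
        have h2 := ha i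
        change π.1.1 i = a.1 i
        omega))
    rw [schur_succ, Fintype.sum_eq_single _ fun π hπ => absurd (hsub π) hπ, ih, mul_one,
      skewCells, Finset.sdiff_self, Finset.card_empty, pow_zero]

/-! ### The product of two rectangular Schur functions -/

section Product

variable {m n k g₁ g₂ : ℕ}

theorem part_rect_of_lt {i : ℕ} (g : ℕ) (h : i < k) : part (rect k g) i = g := part_of_lt _ h

/-- The double sum is `s_{(g₂^k)}(w, y)`, which is symmetric in `w` and leaves the
antisymmetrization. What remains is the Laplace expansion for two empty partitions. -/
theorem antisymm_mul_schur_rect (w : Fin m ⊕ Fin n → A) (y : A) :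
    antisymm g₁ w (fun v => ∑ lam : InBox k g₂, ∑ π : Strip lam.1,
      y ^ (skewCells lam.1 π.1).card * (schur (rotCompl lam) (fun i => v (Sum.inl i)) *
        schur π.1 fun i => v (Sum.inr i))) =
      (m.factorial * n.factorial : ℕ) *
        alternant (fun i => w (finSumFinEquiv.symm i)) (staircase (m + n)) *
        (schur (rect m g₁) (fun i => w (finSumFinEquiv.symm i)) *
          schur (rect k g₂)
            (Fin.snoc (fun i => w (finSumFinEquiv.symm i)) y : Fin (m + n + 1) → A)) := by
  have h0 := antisymm_schur_mul_schur (g := g₁) w (rect 0 0) (rect 0 0) (rect m g₁)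
    (fun i _ => part_of_le _ (Nat.zero_le _))
    (fun i hi => by rw [part_rect_of_lt _ hi, part_of_le _ (Nat.zero_le _), Nat.add_zero])
    (fun i => by rw [part_of_le _ (Nat.le_add_right m i), part_of_le _ (Nat.zero_le _)])
  rw [← mul_assoc, ← h0, antisymm, antisymm, Finset.sum_mul]
  refine Finset.sum_congr rfl fun σ _ => ?_
  rw [schur_eq_one (rect 0 0) _ fun i => i.elim0, schur_eq_one (rect 0 0) _ fun i => i.elim0,
    ← schur_rect_snoc (fun s => w (σ s)) y k g₂ finSumFinEquiv.symm, mul_one, mul_one, mul_assoc]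
  congr 2
  -- `E` separates `w` from `y`, so that a permutation of `w` extends to the whole alphabet by
  -- fixing `y`.
  let E : Fin (m + n + 1) ≃ (Fin m ⊕ Fin n) ⊕ Fin 1 :=
    finSumFinEquiv.symm.trans (finSumFinEquiv.symm.sumCongr (Equiv.refl _))
  have hE : ∀ v : Fin m ⊕ Fin n → A,
      (Fin.snoc (fun i => v (finSumFinEquiv.symm i)) y : Fin (m + n + 1) → A) =
        fun i => Sum.elim v (fun _ => y) (E i) := by
    intro v
    funext i
    induction i using Fin.lastCases with
    | last =>
      have h : (finSumFinEquiv.symm (Fin.last (m + n)) : Fin (m + n) ⊕ Fin 1) = Sum.inr 0 :=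
        finSumFinEquiv_symm_last
      simp only [E, Equiv.trans_apply, h, Fin.snoc_last, Equiv.sumCongr_apply, Sum.map_inr,
        Sum.elim_inr]
    | cast i =>
      have h : (finSumFinEquiv.symm (Fin.castSucc i) : Fin (m + n) ⊕ Fin 1) = Sum.inl i :=
        finSumFinEquiv_symm_apply_castAdd i
      simp only [E, Equiv.trans_apply, h, Fin.snoc_castSucc, Equiv.sumCongr_apply, Sum.map_inl,
        Sum.elim_inl]
  rw [hE w, ← schur_comp_perm _ (fun i => Sum.elim w (fun _ => y) (E i))
    (E.trans ((σ.sumCongr (Equiv.refl _)).trans E.symm))]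
  refine congrArg (schur _) ((hE fun s => w (σ s)).trans ?_)
  funext i
  simp only [Equiv.trans_apply, Equiv.apply_symm_apply]
  rcases E i with s | s
  · rfl
  · rfl

theorem antisymm_sum (w : Fin m ⊕ Fin n → A) {ι : Type*} (s : Finset ι) (c : ι → A)
    (f : ι → (Fin m ⊕ Fin n → A) → A) :
    antisymm g₁ w (fun v => ∑ i ∈ s, c i * f i v) = ∑ i ∈ s, c i * antisymm g₁ w (f i) := by
  simp only [antisymm, Finset.mul_sum]
  rw [Finset.sum_comm]
  exact Finset.sum_congr rfl fun i _ => Finset.sum_congr rfl fun σ _ => by ring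

/-- The product of two rectangular Schur functions, given the expansions of
`antisymm` applied to the products of Schur functions. -/
theorem schur_rect_mul_schur_rect [IsDomain A] [CharZero A] {w : Fin m ⊕ Fin n → A}
    (hw : Function.Injective w) (y : A) (F : (lam : InBox k g₂) → Strip lam.1 → A)
    (hF : ∀ lam π, antisymm g₁ w (fun v => schur (rotCompl lam) (fun i => v (Sum.inl i)) *
        schur π.1 fun i => v (Sum.inr i)) =
      (m.factorial * n.factorial : ℕ) *
        alternant (fun i => w (finSumFinEquiv.symm i)) (staircase (m + n)) * F lam π) :
    schur (rect m g₁) (fun i => w (finSumFinEquiv.symm i)) *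
        schur (rect k g₂)
          (Fin.snoc (fun i => w (finSumFinEquiv.symm i)) y : Fin (m + n + 1) → A) =
      ∑ lam : InBox k g₂, ∑ π : Strip lam.1, y ^ (skewCells lam.1 π.1).card * F lam π := by
  -- Cancelling this factor is what requires a domain of characteristic zero and distinct letters.
  have hc : ((m.factorial * n.factorial : ℕ) : A) *
      alternant (fun i => w (finSumFinEquiv.symm i)) (staircase (m + n)) ≠ 0 :=
    mul_ne_zero (Nat.cast_ne_zero.2 (Nat.mul_ne_zero (Nat.factorial_ne_zero _)
      (Nat.factorial_ne_zero _)))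
      (alternant_staircase_ne_zero _ (hw.comp finSumFinEquiv.symm.injective))
  refine mul_left_cancel₀ hc ?_
  rw [← antisymm_mul_schur_rect]
  have h1 := antisymm_sum (g₁ := g₁) w (Finset.univ : Finset (InBox k g₂)) (fun _ => 1)
    fun lam v => ∑ π : Strip lam.1, y ^ (skewCells lam.1 π.1).card *
      (schur (rotCompl lam) (fun i => v (Sum.inl i)) * schur π.1 fun i => v (Sum.inr i))
  simp only [one_mul] at h1
  rw [h1, Finset.mul_sum]
  refine Finset.sum_congr rfl fun lam _ => ?_
  rw [antisymm_sum, Finset.mul_sum]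
  refine Finset.sum_congr rfl fun π _ => ?_
  rw [hF]
  ring

end Product

/-! ### Tableaux of stacked shapes -/

section Stack

variable {k l : ℕ} {f : Fin k → ℕ} {g : Fin l → ℕ} (hf : Antitone f) (hg : Antitone g)
  (hfg : ∀ i j, g j ≤ f i)

theorem stack_castAdd (i : Fin k) : (stack f g hf hg hfg).1 (Fin.castAdd l i) = f i :=
  Fin.append_left _ _ _

theorem stack_natAdd (i : Fin l) : (stack f g hf hg hfg).1 (Fin.natAdd k i) = g i :=
  Fin.append_right _ _ _

theorem part_stack_of_lt {i : ℕ} (hi : i < k) : part (stack f g hf hg hfg) i = f ⟨i, hi⟩ := by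
  rw [part_of_lt _ (by omega)]
  exact stack_castAdd hf hg hfg ⟨i, hi⟩

theorem part_stack_add (i : ℕ) : part (stack f g hf hg hfg) (k + i) = part ⟨g, hg⟩ i := by
  by_cases hi : i < l
  · rw [part_of_lt _ hi, part_of_lt _ (by omega)]
    exact stack_natAdd hf hg hfg ⟨i, hi⟩
  · rw [part_of_le _ (by omega), part_of_le _ (by omega)]

/-- Branching rule for tableaux of a stacked shape whose largest letter avoids the upper part. -/
theorem sum_restrictedTableau_stack (lam : Ptn l) (hfl : ∀ i j, lam.1 j ≤ f i) {n : ℕ}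
    (x : Fin (n + 1) → A) :
    ∑ T : RestrictedTableau (ferrers (stack f lam.1 hf lam.2 hfl)) n k, weight x T.1 =
      ∑ π : Strip lam, x (Fin.last n) ^ (skewCells lam π.1).card *
        schur (stack f π.1.1 hf π.1.2 fun i j => (π.2.1 j).trans (hfl i j))
          (fun i : Fin n => x i.castSucc) := by
  classical
  rw [sum_restrictedTableau, ← Finset.sum_filter]
  symm
  -- A strip that leaves the upper `k` rows intact is determined by its lower rows.
  have hb : ∀ ρ : Strip (stack f lam.1 hf lam.2 hfl), (∀ i : Fin (k + l), (i : ℕ) < k →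
      ρ.1.1 i = (stack f lam.1 hf lam.2 hfl).1 i) → ∀ i : Fin k,
      ρ.1.1 (Fin.castAdd l i) = f i := fun ρ hρ i => by
    rw [hρ _ i.2, stack_castAdd]
  refine Finset.sum_bij' (fun π _ => ⟨stack f π.1.1 hf π.1.2 fun i j => (π.2.1 j).trans (hfl i j),
      ?_, isHorizontalStrip_iff.2 ?_⟩)
    (fun ρ _ => ⟨⟨fun i => ρ.1.1 (Fin.natAdd k i), fun i j h =>
      ρ.1.2 ((Fin.natAdd_le_natAdd_iff k).2 h)⟩, fun i => ?_,
      isHorizontalStrip_iff.2 fun i j hij => ?_⟩) ?_ ?_ ?_ ?_ ?_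
  · intro i
    refine Fin.addCases (fun i => ?_) (fun i => ?_) i
    · rw [stack_castAdd, stack_castAdd]
    · rw [stack_natAdd, stack_natAdd]
      exact π.2.1 i
  · intro i j
    refine Fin.addCases (fun i => ?_) (fun i => ?_) i <;>
      refine Fin.addCases (fun j => ?_) (fun j => ?_) j <;> intro hij
    · rw [stack_castAdd, stack_castAdd]
      exact hf (Fin.le_def.2 (Fin.le_def.1 hij.le))
    · rw [stack_castAdd, stack_natAdd]
      exact hfl i j
    · have := Fin.lt_def.1 hij
      simp only [Fin.val_natAdd, Fin.val_castAdd] at this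
      omega
    · rw [stack_natAdd, stack_natAdd]
      refine isHorizontalStrip_iff.1 π.2.2 i j (Fin.lt_def.2 ?_)
      have := Fin.lt_def.1 hij
      simpa using this
  · have h := ρ.2.1 (Fin.natAdd k i)
    rwa [stack_natAdd] at h
  · have h := isHorizontalStrip_iff.1 ρ.2.2 (Fin.natAdd k i) (Fin.natAdd k j)
      (Fin.lt_def.2 (by simpa using hij))
    rwa [stack_natAdd] at h
  · intro π _
    refine Finset.mem_filter.2 ⟨Finset.mem_univ _, fun i hi => ?_⟩
    rw [← part_val, ← part_val, part_stack_of_lt _ _ _ hi, part_stack_of_lt _ _ _ hi]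
  · exact fun _ _ => Finset.mem_univ _
  · intro π _
    exact Subtype.ext (Subtype.ext (funext fun i =>
      stack_natAdd hf π.1.2 (fun i j => (π.2.1 j).trans (hfl i j)) i))
  · intro ρ hρ
    refine Subtype.ext (Subtype.ext (funext fun i => ?_))
    refine Fin.addCases (fun i => ?_) (fun i => ?_) i
    · rw [hb ρ (Finset.mem_filter.1 hρ).2 i]
      exact Fin.append_left f _ i
    · exact Fin.append_right f _ i
  · intro π _
    congr 2
    rw [card_skewCells π.2.1, card_skewCells, Fin.sum_univ_add]
    · simp only [stack_castAdd, stack_natAdd, Nat.sub_self, Finset.sum_const_zero, Nat.zero_add]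
    · intro i
      refine Fin.addCases (fun i => ?_) (fun i => ?_) i
      · rw [stack_castAdd, stack_castAdd]
      · rw [stack_natAdd, stack_natAdd]
        exact π.2.1 i

end Stack

/-! ### The two families of composite shapes -/

variable {k g₁ g₂ : ℕ} (h : g₂ ≤ g₁)

theorem part_shapeA_of_lt (lam : InBox k g₂) (π : Strip lam.1) {i : ℕ} (hi : i < k) :
    part (shapeA h lam π) i = g₁ + part (rotCompl lam) i := by
  refine (part_stack_of_lt _ _ _ hi).trans ?_
  rw [part_of_lt _ hi]
  have : lam.1.1 (Fin.rev ⟨i, hi⟩) ≤ g₂ := lam.2 _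
  simp only [rotCompl]
  omega

theorem part_shapeA_add (lam : InBox k g₂) (π : Strip lam.1) (i : ℕ) :
    part (shapeA h lam π) (k + i) = part π.1 i := part_stack_add _ _ _ i

theorem part_shapeB_of_lt (lam : InBoxFull k g₂) (π : Strip lam.1.1) {i : ℕ} (hi : i < k) :
    part (shapeB h lam π) i = g₁ + part (rotCompl lam.1) i := by
  refine (part_stack_of_lt _ _ _ hi).trans ?_
  rw [part_of_lt _ (by omega)]
  have : lam.1.1.1 (Fin.rev (Fin.castSucc ⟨i, hi⟩)) ≤ g₂ := lam.1.2 _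
  simp only [rotCompl]
  change _ = g₁ + (g₂ - lam.1.1.1 (Fin.rev (Fin.castSucc ⟨i, hi⟩)))
  omega

theorem part_shapeB_add (lam : InBoxFull k g₂) (π : Strip lam.1.1) (i : ℕ) :
    part (shapeB h lam π) (k + i) = part π.1 i := part_stack_add _ _ _ i

/-- In `k` letters the Schur function of the complement vanishes unless this part is `0`, which is
the condition `lam_1 = g₂`. -/
theorem part_rotCompl_last (lam : InBox (k + 1) g₂) :
    part (rotCompl lam) k = g₂ - lam.1.1 0 := by
  rw [part_of_lt _ (Nat.lt_succ_self k)]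
  change g₂ - lam.1.1 (Fin.rev (Fin.last k)) = _
  rw [Fin.rev_last]

theorem stack_congr {k l : ℕ} {f f' : Fin k → ℕ} {g : Fin l → ℕ} (hf : Antitone f)
    (hf' : Antitone f') (hg : Antitone g) (hfg : ∀ i j, g j ≤ f i) (hfg' : ∀ i j, g j ≤ f' i)
    (hff : ∀ i, f i = f' i) : stack f g hf hg hfg = stack f' g hf' hg hfg' := by
  obtain rfl : f = f' := funext hff
  rfl

theorem sum_strip_shapeA_eq {n : ℕ} (lam : InBox k g₂) (x : Fin (n + 1) → A) :
    ∑ π : Strip lam.1, x (Fin.last n) ^ (skewCells lam.1 π.1).card *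
        schur (shapeA h lam π) (fun i : Fin n => x i.castSucc) =
      ∑ T : RestrictedTableau (tableauShapeA h lam) n k, weight x T.1 := by
  refine Eq.trans (Finset.sum_congr rfl fun π _ => ?_)
    (sum_restrictedTableau_stack _ lam.1 _ x).symm
  congr 2
  refine stack_congr _ _ _ _ _ fun i => ?_
  have : lam.1.1 i.rev ≤ g₂ := lam.2 _
  simp only [rotCompl]
  omega

theorem sum_strip_shapeB_eq {n : ℕ} (lam : InBoxFull k g₂) (x : Fin (n + 1) → A) :
    ∑ π : Strip lam.1.1, x (Fin.last n) ^ (skewCells lam.1.1 π.1).card *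
        schur (shapeB h lam π) (fun i : Fin n => x i.castSucc) =
      ∑ T : RestrictedTableau (tableauShapeB h lam) n k, weight x T.1 := by
  refine Eq.trans (Finset.sum_congr rfl fun π _ => ?_)
    (sum_restrictedTableau_stack _ lam.1.1 _ x).symm
  congr 2
  refine stack_congr _ _ _ _ _ fun i => ?_
  have : lam.1.1.1 i.castSucc.rev ≤ g₂ := lam.1.2 _
  simp only [rotCompl]
  omega

theorem part_rotCompl_le (lam : InBox k g₂) (i : ℕ) : part (rotCompl lam) i ≤ g₂ := by
  rw [part]
  split_ifs
  · exact Nat.sub_le _ _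
  · exact Nat.zero_le _

/-! ### Fewer letters than rows -/

section Degenerate

/-- If there are fewer letters than rows of the first rectangle, both sides vanish unless all
partitions are zero. -/
theorem schur_rect_mul_schur_rect_of_lt {K l n : ℕ} (hn : n < k) (h : g₂ ≤ g₁)
    {P : InBox l g₂ → Prop}
    [Fintype {lam : InBox l g₂ // P lam}] (hP : g₂ = 0 → ∃ lam, P lam)
    (S : (lam : {lam : InBox l g₂ // P lam}) → Strip lam.1.1 → Ptn K)
    (hS : ∀ lam π i, i < k → part (S lam π) i = g₁ + part (rotCompl lam.1) i) (x : Fin (n + 1) → A) :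
    schur (rect k g₁) (fun i : Fin n => x i.castSucc) * schur (rect l g₂) x =
      ∑ lam : {lam : InBox l g₂ // P lam}, ∑ π : Strip lam.1.1,
        x (Fin.last n) ^ (skewCells lam.1.1 π.1).card *
          schur (S lam π) (fun i : Fin n => x i.castSucc) := by
  -- If `g₁ = 0`, every partition is empty and both sides equal `1`; otherwise the first factor and
  -- every `S lam π` have more than `n` nonzero parts.
  by_cases hg : g₁ = 0
  · obtain rfl : g₂ = 0 := by omega
    have h0 : ∀ lam : InBox l 0, ∀ i, lam.1.1 i = 0 := fun lam i => Nat.le_zero.1 (lam.2 i)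
    have hle : ∀ (lam : InBox l 0) (π : Strip lam.1), ∀ i, π.1.1 i = 0 := fun lam π i =>
      Nat.le_zero.1 ((π.2.1 i).trans (h0 lam i).le)
    have s1 : Subsingleton {lam : InBox l 0 // P lam} := ⟨fun a b =>
      Subtype.ext (Subtype.ext (Subtype.ext (funext fun i => by rw [h0, h0])))⟩
    have s2 : ∀ lam : InBox l 0, Subsingleton (Strip lam.1) := fun lam => ⟨fun a b =>
      Subtype.ext (Subtype.ext (funext fun i => by rw [hle, hle]))⟩
    obtain ⟨lam, hlam⟩ := hP rfl
    let π : Strip lam.1 := ⟨lam.1, le_rfl, isHorizontalStrip_iff.2 fun i j h => lam.1.2 h.le⟩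
    have s3 := s2 lam
    have hzero : ∀ i, (S ⟨lam, hlam⟩ π).1 i = 0 := fun i => by
      have h1 := part_antitone (S ⟨lam, hlam⟩ π) (Nat.zero_le i)
      rw [hS _ _ 0 (by omega), hg, part_val] at h1
      exact Nat.le_zero.1 (h1.trans ((Nat.zero_add _).le.trans (part_rotCompl_le lam 0)))
    rw [Fintype.sum_subsingleton _ ⟨lam, hlam⟩, Fintype.sum_subsingleton _ π,
      schur_eq_one _ _ fun i => hg, schur_eq_one _ _ fun i => rfl,
      schur_eq_one _ _ hzero, skewCells, Finset.sdiff_self, Finset.card_empty,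
      pow_zero, mul_one]
  · rw [schur_eq_zero (rect k g₁) _ le_rfl (by rwa [part_rect_of_lt _ hn]), zero_mul]
    symm
    refine Finset.sum_eq_zero fun lam _ => Finset.sum_eq_zero fun π _ => ?_
    rw [schur_eq_zero _ _ le_rfl (by rw [hS _ _ _ hn]; omega), mul_zero]

end Degenerate

/-! ### Enough letters: generic variables and specialization -/

/-- The first expansion of the product, for sufficiently many variables. -/
theorem schur_rect_mul_schur_rect_of_le {K l m n : ℕ} {P : InBox l g₂ → Prop}
    [Fintype {lam : InBox l g₂ // P lam}]
    (hP : ∀ lam, P lam ↔ ∀ i, m ≤ i → part (rotCompl lam) i = 0)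
    (S : (lam : {lam : InBox l g₂ // P lam}) → Strip lam.1.1 → Ptn K)
    (hS : ∀ lam π i, i < m → part (S lam π) i = g₁ + part (rotCompl lam.1) i)
    (hS' : ∀ lam π i, part (S lam π) (m + i) = part π.1 i) (x : Fin (m + n + 1) → A) :
    schur (rect m g₁) (fun i : Fin (m + n) => x i.castSucc) * schur (rect l g₂) x =
      ∑ lam : {lam : InBox l g₂ // P lam}, ∑ π : Strip lam.1.1,
        x (Fin.last (m + n)) ^ (skewCells lam.1.1 π.1).card *
          schur (S lam π) (fun i : Fin (m + n) => x i.castSucc) := by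
  classical
  let X : Fin (m + n + 1) → MvPolynomial (Fin (m + n + 1)) ℤ := MvPolynomial.X
  let w : Fin m ⊕ Fin n → MvPolynomial (Fin (m + n + 1)) ℤ := fun s =>
    X (finSumFinEquiv s).castSucc
  have hw : Function.Injective w := fun s t hst => finSumFinEquiv.injective
    (Fin.castSucc_injective _ (MvPolynomial.X_injective hst))
  have hwX : (fun i => w (finSumFinEquiv.symm i)) = fun i : Fin (m + n) => X i.castSucc := by
    funext i
    simp only [w, Equiv.apply_symm_apply]
  have hX : (Fin.snoc (fun i => w (finSumFinEquiv.symm i)) (X (Fin.last (m + n))) :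
      Fin (m + n + 1) → MvPolynomial (Fin (m + n + 1)) ℤ) = X := by
    rw [hwX]
    exact Fin.snoc_init_self X
  have key := schur_rect_mul_schur_rect (g₁ := g₁) (g₂ := g₂) (k := l) hw (X (Fin.last (m + n)))
    (fun lam π => if hlam : P lam then
      schur (S ⟨lam, hlam⟩ π) (fun i : Fin (m + n) => X i.castSucc) else 0) (by
    intro lam π
    by_cases hlam : P lam
    · rw [dif_pos hlam, antisymm_schur_mul_schur w (rotCompl lam) π.1 (S ⟨lam, hlam⟩ π)
        ((hP lam).1 hlam) (hS ⟨lam, hlam⟩ π) (hS' ⟨lam, hlam⟩ π), hwX]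
    -- Here `lam°` has more than `m` parts, so its Schur function in the first block is zero.
    · rw [dif_neg hlam, mul_zero, antisymm]
      rw [hP] at hlam
      push Not at hlam
      obtain ⟨i, hi, hne⟩ := hlam
      refine Finset.sum_eq_zero fun σ _ => ?_
      simp only [schur_eq_zero (rotCompl lam) _ hi hne, zero_mul, mul_zero])
  rw [hX, hwX] at key
  have key2 : schur (rect m g₁) (fun i : Fin (m + n) => X i.castSucc) * schur (rect l g₂) X =
      ∑ lam : {lam : InBox l g₂ // P lam}, ∑ π : Strip lam.1.1,
        X (Fin.last (m + n)) ^ (skewCells lam.1.1 π.1).card *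
          schur (S lam π) (fun i : Fin (m + n) => X i.castSucc) := by
    rw [key, ← Finset.sum_filter_of_ne (p := P) fun lam _ hne => ?_,
      Finset.sum_subtype _ (p := P) fun lam => by simp]
    · refine Finset.sum_congr rfl fun lam _ => Finset.sum_congr rfl fun π _ => ?_
      rw [dif_pos lam.2]
    · by_contra hlam
      refine hne (Finset.sum_eq_zero fun π _ => ?_)
      rw [dif_neg hlam, mul_zero]
  have h3 := congrArg (MvPolynomial.eval₂Hom (Int.castRingHom A) x) key2
  simpa only [map_mul, map_sum, map_pow, map_schur, X, MvPolynomial.coe_eval₂Hom,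
    MvPolynomial.eval₂_X] using h3

end RectSchur

theorem theorem2 {A : Type*} [CommRing A] (α n γ₁ γ₂ : ℕ) (h : γ₂ ≤ γ₁) (x : Fin (n + 1) → A) :
    (RectSchur.schur (RectSchur.rect α γ₁) (fun i : Fin n => x i.castSucc) *
          RectSchur.schur (RectSchur.rect α γ₂) x
        = ∑ lam : RectSchur.InBox α γ₂, ∑ π : RectSchur.Strip lam.1,
            x (Fin.last n) ^ (RectSchur.skewCells lam.1 π.1).card *
              RectSchur.schur (RectSchur.shapeA h lam π) (fun i : Fin n => x i.castSucc) ∧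
      RectSchur.schur (RectSchur.rect α γ₁) (fun i : Fin n => x i.castSucc) *
          RectSchur.schur (RectSchur.rect α γ₂) x
        = ∑ lam : RectSchur.InBox α γ₂,
            ∑ T : RectSchur.RestrictedTableau (RectSchur.tableauShapeA h lam) n α,
              RectSchur.weight x T.1) ∧
    (RectSchur.schur (RectSchur.rect α γ₁) (fun i : Fin n => x i.castSucc) *
          RectSchur.schur (RectSchur.rect (α + 1) γ₂) x
        = ∑ lam : RectSchur.InBoxFull α γ₂, ∑ π : RectSchur.Strip lam.1.1,
            x (Fin.last n) ^ (RectSchur.skewCells lam.1.1 π.1).card *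
              RectSchur.schur (RectSchur.shapeB h lam π) (fun i : Fin n => x i.castSucc) ∧
      RectSchur.schur (RectSchur.rect α γ₁) (fun i : Fin n => x i.castSucc) *
          RectSchur.schur (RectSchur.rect (α + 1) γ₂) x
        = ∑ lam : RectSchur.InBoxFull α γ₂,
            ∑ T : RectSchur.RestrictedTableau (RectSchur.tableauShapeB h lam) n α,
              RectSchur.weight x T.1) := by
  open RectSchur in
  have keyA : schur (rect α γ₁) (fun i : Fin n => x i.castSucc) * schur (rect α γ₂) x =
      ∑ lam : InBox α γ₂, ∑ π : Strip lam.1, x (Fin.last n) ^ (skewCells lam.1 π.1).card *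
        schur (shapeA h lam π) (fun i : Fin n => x i.castSucc) := by
    -- The trivial predicate fits the general expansion: a complement in `(γ₂^α)` never has more
    -- than `α` parts.
    have key : schur (rect α γ₁) (fun i : Fin n => x i.castSucc) * schur (rect α γ₂) x =
        ∑ lam : {_lam : InBox α γ₂ // True}, ∑ π : Strip lam.1.1,
          x (Fin.last n) ^ (skewCells lam.1.1 π.1).card *
            schur (shapeA h lam.1 π) (fun i : Fin n => x i.castSucc) := by
      rcases lt_or_ge n α with hn | hn
      · exact schur_rect_mul_schur_rect_of_lt hn h
          (fun _ => ⟨⟨⟨fun _ => 0, fun _ _ _ => le_rfl⟩, fun _ => Nat.zero_le _⟩, trivial⟩)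
          (fun lam π => shapeA h lam.1 π) (fun lam π i hi => part_shapeA_of_lt h lam.1 π hi) x
      · obtain ⟨m, rfl⟩ := Nat.exists_eq_add_of_le hn
        exact schur_rect_mul_schur_rect_of_le
          (fun lam => iff_of_true trivial fun i hi => part_of_le _ hi)
          (fun lam π => shapeA h lam.1 π) (fun lam π i hi => part_shapeA_of_lt h lam.1 π hi)
          (fun lam π i => part_shapeA_add h lam.1 π i) x
    rw [key]
    exact Fintype.sum_equiv (Equiv.subtypeUnivEquiv fun _ => trivial) _ _ fun _ => rfl
  open RectSchur in
  have keyB : schur (rect α γ₁) (fun i : Fin n => x i.castSucc) * schur (rect (α + 1) γ₂) x =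
      ∑ lam : InBoxFull α γ₂, ∑ π : Strip lam.1.1,
        x (Fin.last n) ^ (skewCells lam.1.1 π.1).card *
          schur (shapeB h lam π) (fun i : Fin n => x i.castSucc) := by
    rcases lt_or_ge n α with hn | hn
    · exact schur_rect_mul_schur_rect_of_lt (P := fun lam : InBox (α + 1) γ₂ => lam.1.1 0 = γ₂)
        hn h (fun h0 => ⟨⟨⟨fun _ => 0, fun _ _ _ => le_rfl⟩, fun _ => Nat.zero_le _⟩, h0.symm⟩)
        (shapeB h) (fun lam π i hi => part_shapeB_of_lt h lam π hi) x
    · obtain ⟨m, rfl⟩ := Nat.exists_eq_add_of_le hn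
      refine schur_rect_mul_schur_rect_of_le (P := fun lam : InBox (α + 1) γ₂ => lam.1.1 0 = γ₂)
        (fun lam => ⟨fun hlam i hi => ?_, fun hlam => ?_⟩)
        (shapeB h) (fun lam π i hi => part_shapeB_of_lt h lam π hi)
        (fun lam π i => part_shapeB_add h lam π i) x
      · rcases hi.eq_or_lt with rfl | hi
        · rw [part_rotCompl_last, hlam, Nat.sub_self]
        · exact part_of_le _ hi
      · have h1 := hlam α le_rfl
        rw [part_rotCompl_last] at h1
        have h2 : lam.1.1 0 ≤ γ₂ := lam.2 0
        omega
  exact ⟨⟨keyA, keyA.trans (Finset.sum_congr rfl fun lam _ =>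
    RectSchur.sum_strip_shapeA_eq h lam x)⟩, keyB, keyB.trans (Finset.sum_congr rfl fun lam _ =>
    RectSchur.sum_strip_shapeB_eq h lam x)⟩
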